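/- Let $d\ge 1$, $X=\mathbb R^d$ and $\mathbb R_+=(0,\infty)$. Let $\mathbb K(X)$ be the set of discrete Radon measures $\eta=\sum_i s_i\delta_{x_i}$ on $X$ (at most countably many distinct atoms $x_i\in X$, weights $s_i>0$, $\eta$ finite on compact sets, $\eta=0$ allowed), with the $\sigma$-algebra generated by the maps $\eta\mapsto\eta(\Lambda)$, $\Lambda\subset X$ bounded Borel. Write $\tau(\eta)$ for the set of atoms of $\eta$ and $s_x=\eta(\{x\})$ for $x\in\tau(\eta)$. Let $\operatorname{Diff}_0(X)$ be the group of $C^\infty$ diffeomorphisms of $X$ that equal the identity outside a compact set; $\varphi\in\operatorname{Diff}_0(X)$ acts on $\mathbb K(X)$ by $\eta\mapsto\varphi^*\eta$ (pushforward) and on $X\times\mathbb R_+$ by $(x,s)\mapsto(\varphi(x),s)$. Denote by $\mu^\varphi$ and $m_\varphi$ the pushforwards under these maps of a measure $\mu$ on $\mathbb K(X)$ and of a measure $m$ on $X\times\mathbb R_+$. A measure $\mu$ on $\mathbb K(X)$ is called $\operatorname{Diff}_0(X)$-quasi-invariant if $\mu^\varphi$ and $\mu$ are equivalent (mutually absolutely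 continuous) for every $\varphi\in\operatorname{Diff}_0(X)$. Put $J_\varphi(x)=|\det D(\varphi^{-1})(x)|$, the density at $x$ of the pushforward of Lebesgue measure under $\varphi$. For a measure $m$ on $X\times\mathbb R_+$, let $\mu_m$ denote the completely random discrete measure with Lévy measure $m$, i.e. the probability measure on $\mathbb K(X)$ under which $\eta(A_1),\dots,\eta(A_n)$ are independent for all $n\ge2$ and all mutually disjoint bounded Borel sets $A_1,\dots,A_n$, and such that for every continuous compactly supported $f:X\to\mathbb R$ $$\int_{\mathbb K(X)}e^{i\langle f,\eta\rangle}\,d\mu_m(\eta)=\exp\left[\int_{X\times\mathbb R_+}\left(e^{isf(x)}-1\right)dm(x,s)\right],\qquad \langle f,\eta\rangle=\int_X f\,d\eta .$$ (a) Suppose that $m(\{x\}\times\mathbb R_+)=0$ for every $x\in X$, that $m_\varphi$ and $m$ are equivalent for every $\varphi\in\operatorname{Diff}_0(X)$, and that $m(\Lambda\times\mathbb R_+)<\infty$ for every bounded Borel set $\Lambda\subset X$. Then $\mu_m$ exists and is unique, it is $\operatorname{Diff}_0(X)$-quasi-invariant, and for every $\varphi\in\operatorname{Diff}_0(X)$ $$\frac{d\mu_m^\varphi}{d\mu_m}(\eta)=\prod_{x\in\tau(\eta)}\frac{dm_\varphi}{dm}(x,s_x)\qquad\text{for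 }\mu_m\text{-a.e. }\eta,$$ where the product converges unconditionally. (b) Suppose that $dm(x,s)=\frac{l(x,s)}{s}\,dx\,ds$ with $l:X\times\mathbb R_+\to(0,\infty)$ measurable, and that $m(\Lambda\times\mathbb R_+)<\infty$ for every bounded Borel set $\Lambda\subset X$. Then $\mu_m$ exists and is unique, it is $\operatorname{Diff}_0(X)$-quasi-invariant, and for every $\varphi\in\operatorname{Diff}_0(X)$ $$\frac{d\mu_m^\varphi}{d\mu_m}(\eta)=\prod_{x\in\tau(\eta)}\frac{l(\varphi^{-1}(x),s_x)}{l(x,s_x)}\,J_\varphi(x)\qquad\text{for }\mu_m\text{-a.e. }\eta,$$ where the product converges unconditionally. -/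

import Mathlib

open MeasureTheory ProbabilityTheory
open scoped ENNReal

/-- The space `X = ℝ^d`. -/
abbrev Euc (d : ℕ) : Type := EuclideanSpace ℝ (Fin d)

/-- The half-line `ℝ₊ = (0, ∞)`. -/
abbrev PosReal : Type := Set.Ioi (0 : ℝ)

/-- The cone `𝕂(X)` of discrete Radon measures on `X = ℝ^d`: measures that are finite on compact
sets and of the form `∑ s_x δ_x`, the sum being over an at most countable set of (distinct) points
`x`, with weights `s_x > 0`. The null measure is included (empty set of atoms). -/
@[ext] structure DiscreteMeasure (d : ℕ) where
  /-- the underlying measure on `X` -/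
  toMeasure : Measure (Euc d)
  finite_of_isCompact : ∀ C : Set (Euc d), IsCompact C → toMeasure C < ∞
  discrete : ∃ (S : Set (Euc d)) (s : Euc d → ℝ), S.Countable ∧ (∀ x ∈ S, 0 < s x) ∧
    toMeasure = Measure.sum (fun x : S => ENNReal.ofReal (s x) • Measure.dirac (x : Euc d))

namespace DiscreteMeasure

variable {d : ℕ}

/-- The `σ`-algebra on `𝕂(X)` generated by the maps `η ↦ η(Λ)`, with `Λ` bounded Borel. It is
the trace on `𝕂(X)` of the Borel `σ`-algebra of the vague topology on Radon measures. -/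
instance : MeasurableSpace (DiscreteMeasure d) :=
  ⨆ (Λ : Set (Euc d)) (_ : MeasurableSet Λ) (_ : Bornology.IsBounded Λ),
    MeasurableSpace.comap (fun η : DiscreteMeasure d => η.toMeasure Λ) inferInstance

/-- The set of atoms `τ(η) = {x | η({x}) > 0}`. -/
def atoms (η : DiscreteMeasure d) : Set (Euc d) := {x | η.toMeasure {x} ≠ 0}

/-- The weight `s_x = η({x}) ∈ ℝ₊` of an atom `x ∈ τ(η)`. -/
def weight (η : DiscreteMeasure d) (x : η.atoms) : PosReal :=
  ⟨(η.toMeasure {(x : Euc d)}).toReal,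
    ENNReal.toReal_pos x.2 (η.finite_of_isCompact _ isCompact_singleton).ne⟩

theorem measurable_apply {Λ : Set (Euc d)} (hΛ : MeasurableSet Λ) (hb : Bornology.IsBounded Λ) :
    Measurable (fun η : DiscreteMeasure d => η.toMeasure Λ) :=
  measurable_iff_comap_le.2
    (le_iSup_of_le Λ (le_iSup_of_le hΛ (le_iSup_of_le hb le_rfl)))

end DiscreteMeasure

/-- The set `Diff₀(X)` of smooth diffeomorphisms of `X = ℝ^d` that are equal to the identity
outside a compact set. -/
structure Diff0 (d : ℕ) extends Euc d ≃ Euc d where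
  contDiff_toFun : ContDiff ℝ (⊤ : ℕ∞) toFun
  contDiff_invFun : ContDiff ℝ (⊤ : ℕ∞) invFun
  compact_support : ∃ C : Set (Euc d), IsCompact C ∧ ∀ x ∉ C, toFun x = x

namespace Diff0

variable {d : ℕ}

/-- A diffeomorphism, as a homeomorphism. -/
def toHomeo (φ : Diff0 d) : Euc d ≃ₜ Euc d where
  toEquiv := φ.toEquiv
  continuous_toFun := φ.contDiff_toFun.continuous
  continuous_invFun := φ.contDiff_invFun.continuous

/-- The Jacobian factor `J_φ(x) = |det D(φ⁻¹)(x)|`, which is the density at `x` of the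
pushforward of Lebesgue measure under `φ`. -/
noncomputable def jac (φ : Diff0 d) (x : Euc d) : ℝ := |(fderiv ℝ φ.invFun x).det|

/-- The action `(x, s) ↦ (φ(x), s)` on `X × ℝ₊`. -/
def lift (φ : Diff0 d) (p : Euc d × PosReal) : Euc d × PosReal := (φ.toFun p.1, p.2)

/-- The action `η ↦ φ^*η` (pushforward) on `𝕂(X)`, that is `∑ s_i δ_{x_i} ↦ ∑ s_i δ_{φ(x_i)}`. -/
noncomputable def act (φ : Diff0 d) (η : DiscreteMeasure d) : DiscreteMeasure d where
  toMeasure := η.toMeasure.map φ.toFun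
  finite_of_isCompact C hC := by
    have hφ : Measurable φ.toFun := φ.toHomeo.continuous.measurable
    rw [Measure.map_apply hφ hC.measurableSet]
    exact η.finite_of_isCompact _ (φ.toHomeo.isCompact_preimage.2 hC)
  discrete := by
    obtain ⟨S, s, hS, hs, h⟩ := η.discrete
    have hφ : Measurable φ.toFun := φ.toHomeo.continuous.measurable
    refine ⟨φ.toFun '' S, fun y => s (φ.invFun y), hS.image _, ?_, ?_⟩
    · rintro _ ⟨x, hx, rfl⟩
      simpa [φ.left_inv x] using hs x hx
    · ext A hA
      rw [Measure.map_apply hφ hA, h, Measure.sum_apply _ (hφ hA), Measure.sum_apply _ hA]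
      rw [← (Equiv.Set.image φ.toFun S φ.toEquiv.injective).tsum_eq]
      refine tsum_congr fun x => ?_
      simp [Measure.dirac_apply' _ hA, Set.indicator]
      rfl

theorem measurable_act (φ : Diff0 d) : Measurable φ.act := by
  rw [measurable_iff_comap_le]
  have hφ : Measurable φ.toFun := φ.toHomeo.continuous.measurable
  simp only [DiscreteMeasure.instMeasurableSpace, MeasurableSpace.comap_iSup,
    MeasurableSpace.comap_comp]
  refine iSup_le fun Λ => iSup_le fun hΛ => iSup_le fun hb => ?_
  have hb' : Bornology.IsBounded (φ.toFun ⁻¹' Λ) :=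
    (φ.toHomeo.isCompact_preimage.2 hb.isCompact_closure).isBounded.subset
      (Set.preimage_mono subset_closure)
  have h := DiscreteMeasure.measurable_apply (hφ hΛ) hb'
  have he : (fun η : DiscreteMeasure d => η.toMeasure Λ) ∘ φ.act =
      fun η => η.toMeasure (φ.toFun ⁻¹' Λ) := by
    funext η
    exact Measure.map_apply hφ hΛ
  rw [he]
  exact measurable_iff_comap_le.1 h

end Diff0

/-- Equivalence (mutual absolute continuity) of measures. -/
def MeasEquiv {α : Type*} [MeasurableSpace α] (μ ν : Measure α) : Prop := μ ≪ ν ∧ ν ≪ μ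

/-- A probability measure `μ` on `𝕂(X)` is (the law of) a completely random measure: for any
`n ≥ 2` and any mutually disjoint bounded Borel sets `A₁, …, Aₙ`, the random variables
`η(A₁), …, η(Aₙ)` are independent under `μ`. -/
def IsCompletelyRandom {d : ℕ} (μ : Measure (DiscreteMeasure d)) : Prop :=
  ∀ (n : ℕ) (A : Fin n → Set (Euc d)), 2 ≤ n → (∀ i, MeasurableSet (A i)) →
    (∀ i, Bornology.IsBounded (A i)) → Pairwise (fun i j => Disjoint (A i) (A j)) →
    iIndepFun (fun i (η : DiscreteMeasure d) => η.toMeasure (A i)) μ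

/-- `μ` is the completely random discrete measure `μ_m` with Lévy measure `m`: a probability
measure on `𝕂(X)` that is completely random and whose Fourier transform is
`∫ e^{i⟨f,η⟩} dμ(η) = exp (∫ (e^{i s f(x)} - 1) dm(x,s))` for continuous compactly supported
`f : X → ℝ`. -/
structure IsCompletelyRandomWithLevyMeasure {d : ℕ} (m : Measure (Euc d × PosReal))
    (μ : Measure (DiscreteMeasure d)) : Prop where
  isProbabilityMeasure : IsProbabilityMeasure μ
  isCompletelyRandom : IsCompletelyRandom μ
  fourier : ∀ f : Euc d → ℝ, Continuous f → HasCompactSupport f →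
    ∫ η, Complex.exp (Complex.I * ((∫ x, f x ∂η.toMeasure : ℝ) : ℂ)) ∂μ =
      Complex.exp (∫ p : Euc d × PosReal,
        (Complex.exp (Complex.I * (((p.2 : ℝ) * f p.1 : ℝ) : ℂ)) - 1) ∂m)

/-- Quasi-invariance of a measure `μ` on `𝕂(X)` under the action of `Diff₀(X)`: for each `φ`,
the pushforward `μ^φ` of `μ` under `η ↦ φ^*η` is equivalent to `μ`. -/
def IsDiffQuasiInvariant {d : ℕ} (μ : Measure (DiscreteMeasure d)) : Prop :=
  ∀ φ : Diff0 d, MeasEquiv (μ.map φ.act) μ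

/-- The measure `dm(x,s) = (l(x,s)/s) dx ds` on `X × ℝ₊`. -/
noncomputable def levyOfDensity {d : ℕ} (l : Euc d × PosReal → ℝ) : Measure (Euc d × PosReal) :=
  ((volume : Measure (Euc d)).prod ((volume : Measure ℝ).comap Subtype.val)).withDensity
    (fun p => ENNReal.ofReal (l p / (p.2 : ℝ)))

/-! Since `m` is finite over bounded sets, `μ_m` is the law of a marked Poisson process. Cut `X`
into the shells `k ≤ ‖x‖ < k + 1`, sample independently in each one a Poisson configuration whose
intensity is the finite restriction of `m`, and sum `s δ_x` over all sampled points. The atoms are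
then locally finite, and almost surely distinct because `m` charges no fibre over a point.
Everything is computed from the exponential formula `E ∏ u(p) = exp ∫ (u - 1) dm`
(`integral_poissonConfig_prod`): it gives the Fourier transform and, applied to combinations of
indicators of disjoint sets, independence. Uniqueness holds because the Fourier transform determines
a finite measure on the cone (`DiscreteMeasure.ext_of_fourier`).

For the density, let `φ` be the identity outside a ball `B`. Then `m_φ = m` off `B`, so `dm_φ/dm =
e^v` with `v = 0` off `B`, and the product over atoms is the finite product `exp ∑ v(x, s_x)` over
atoms in `B`. The exponential formula with this weight gives `E[e^{i⟨f,η⟩} e^{∑ v}] = exp ∫ (e^{isf}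
e^v - 1) dm = exp ∫ (e^{isf} - 1) dm_φ`. The last equality uses that `φ` maps large balls onto
themselves, so `m` and `m_φ` give them the same finite mass. The right side is the Fourier transform
of `μ_m^φ`, so `e^{∑ v}` is its density (`map_act_eq_withDensity`). It is strictly positive, hence
the two measures are equivalent.

One point needs care: `∑ v(x, s_x)` must be measurable for a `σ`-algebra that knows only the masses
`η(Λ)`. The marked atoms are recovered as limits along refining countable partitions, whose cells
eventually separate any finite set of atoms.

Part (b) is the change of variables formula for `φ⁻¹`, inserted in (a). -/

/-! ### Measurability of masses from integrals of test functions -/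

theorem continuous_thickenedIndicator_coe {X : Type*} [PseudoEMetricSpace X] {δ : ℝ} (hδ : 0 < δ)
    (C : Set X) : Continuous fun x => (thickenedIndicator hδ C x : ℝ) :=
  NNReal.continuous_coe.comp (thickenedIndicator hδ C).continuous

theorem hasCompactSupport_thickenedIndicator {X : Type*} [PseudoMetricSpace X] [ProperSpace X]
    {δ : ℝ} (hδ : 0 < δ) {C : Set X} (hC : Bornology.IsBounded C) :
    HasCompactSupport fun x => (thickenedIndicator hδ C x : ℝ) := by
  refine HasCompactSupport.intro (K := closure (Metric.thickening δ C))
    hC.thickening.isCompact_closure fun x hx => ?_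
  rw [thickenedIndicator_zero hδ C fun h => hx (subset_closure h)]
  rfl

/-- A family of measures, finite on compact sets, is measurable if the integrals of continuous
compactly supported functions are. -/
theorem measurable_apply_of_measurable_integral {Ω X : Type*} [MeasurableSpace Ω]
    [PseudoMetricSpace X] [ProperSpace X] [MeasurableSpace X] [BorelSpace X] (κ : Ω → Measure X)
    (hfin : ∀ ω, ∀ C : Set X, IsCompact C → κ ω C < ∞)
    (hκ : ∀ f : X → ℝ, Continuous f → HasCompactSupport f → Measurable fun ω => ∫ x, f x ∂κ ω)
    {Λ : Set X} (hΛ : MeasurableSet Λ) (hb : Bornology.IsBounded Λ) :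
    Measurable fun ω => κ ω Λ := by
  have hcomp : ∀ C : Set X, IsCompact C → IsClosed C → Measurable fun ω => κ ω C := by
    intro C hC hCc
    have hδ : ∀ n : ℕ, (0 : ℝ) < 1 / (n + 1) := fun n => Nat.one_div_pos_of_nat
    refine measurable_of_tendsto_metrizable
      (f := fun (n : ℕ) ω => ENNReal.ofReal (∫ x, (thickenedIndicator (hδ n) C x : ℝ) ∂κ ω))
      (fun n => ENNReal.measurable_ofReal.comp (hκ _ (continuous_thickenedIndicator_coe _ _)
        (hasCompactSupport_thickenedIndicator (hδ n) hC.isBounded))) ?_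
    rw [tendsto_pi_nhds]
    intro ω
    -- All thickenings used have radius `1 / (n + 1) ≤ 2`, so one compact `B` contains them and the
    -- convergence takes place in a finite measure.
    set B := closure (Metric.thickening 2 C) with hB
    have hBc : IsCompact B := hC.isBounded.thickening.isCompact_closure
    have hCB : C ⊆ B := (Metric.self_subset_thickening two_pos C).trans subset_closure
    have : IsFiniteMeasure ((κ ω).restrict B) := isFiniteMeasure_restrict.2 (hfin ω B hBc).ne
    have h := tendsto_lintegral_thickenedIndicator_of_isClosed ((κ ω).restrict B) hCc hδ
      tendsto_one_div_add_atTop_nhds_zero_nat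
    rw [Measure.restrict_apply hCc.measurableSet, Set.inter_eq_left.2 hCB] at h
    refine h.congr fun n => ?_
    have hz : ∀ x ∉ B, (thickenedIndicator (hδ n) C x : ℝ) = 0 := by
      intro x hx
      rw [thickenedIndicator_zero (hδ n) C fun hm => hx (subset_closure
        (Metric.thickening_mono (?_ : (1 : ℝ) / (n + 1) ≤ 2) C hm))]
      · rfl
      · rw [div_le_iff₀ (by positivity)]; nlinarith [Nat.cast_nonneg (α := ℝ) n]
    rw [← setIntegral_eq_integral_of_forall_compl_eq_zero hz,
      ofReal_integral_eq_lintegral_ofReal]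
    · simp
    · have := this
      refine Integrable.of_bound (continuous_thickenedIndicator_coe
        (hδ n) C).measurable.aestronglyMeasurable 1 (Filter.Eventually.of_forall fun x => ?_)
      simpa using thickenedIndicator_le_one (hδ n) C x
    · exact Filter.Eventually.of_forall fun x => NNReal.coe_nonneg _
  have hK : IsCompact (closure Λ) := hb.isCompact_closure
  have : ∀ ω, IsFiniteMeasure ((κ ω).restrict (closure Λ)) := fun ω =>
    isFiniteMeasure_restrict.2 (hfin ω _ hK).ne
  -- Closed sets form a generating `π`-system; restricting to `closure Λ` makes the measures finite
  -- and the relevant closed sets compact.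
  have hm : Measurable fun ω => (κ ω).restrict (closure Λ) := by
    refine Measurable.measure_of_isPiSystem (S := {s | IsClosed s})
      (BorelSpace.measurable_eq.trans borel_eq_generateFrom_isClosed) isPiSystem_isClosed
      (fun s hs => ?_) ?_
    · have hs' : IsClosed s := hs
      simp only [Measure.restrict_apply hs'.measurableSet]
      exact hcomp _ (hK.inter_left hs') (hs'.inter isClosed_closure)
    · simp only [Measure.restrict_apply MeasurableSet.univ, Set.univ_inter]
      exact hcomp _ hK isClosed_closure
  have := (Measure.measurable_coe hΛ).comp hm
  simpa [Function.comp_def, Measure.restrict_apply hΛ, Set.inter_eq_left.2 subset_closure]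
    using this

/-! ### The Fourier transform determines a measure on the cone -/

namespace DiscreteMeasure

variable {d : ℕ}

theorem apply_lt_top_of_isBounded (η : DiscreteMeasure d) {Λ : Set (Euc d)}
    (hb : Bornology.IsBounded Λ) : η.toMeasure Λ < ∞ :=
  (measure_mono subset_closure).trans_lt (η.finite_of_isCompact _ hb.isCompact_closure)

theorem measurable_restrict {B : Set (Euc d)} (hB : MeasurableSet B)
    (hb : Bornology.IsBounded B) :
    Measurable fun η : DiscreteMeasure d => η.toMeasure.restrict B := by
  refine Measure.measurable_of_measurable_coe _ fun s hs => ?_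
  simp only [Measure.restrict_apply hs]
  exact measurable_apply (hs.inter hB) (hb.subset Set.inter_subset_right)

theorem measurable_integral {f : Euc d → ℝ} (hf : Continuous f) (hc : HasCompactSupport f) :
    Measurable fun η : DiscreteMeasure d => ∫ x, f x ∂η.toMeasure := by
  have hB := measurable_restrict (d := d) (isClosed_tsupport f).measurableSet hc.isCompact.isBounded
  have := (StronglyMeasurable.integral_kernel
    (κ := (⟨_, hB⟩ : Kernel (DiscreteMeasure d) (Euc d))) hf.stronglyMeasurable).measurable
  convert this using 2 with η
  exact (setIntegral_eq_integral_of_forall_compl_eq_zero fun x hx =>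
    image_eq_zero_of_notMem_tsupport hx).symm

theorem integrable_of_hasCompactSupport (η : DiscreteMeasure d) {f : Euc d → ℝ}
    (hf : Continuous f) (hc : HasCompactSupport f) : Integrable f η.toMeasure := by
  have : IsFiniteMeasureOnCompacts η.toMeasure := ⟨fun C hC => η.finite_of_isCompact C hC⟩
  exact hf.integrable_of_hasCompactSupport hc

/-- The index type of continuous compactly supported functions. -/
abbrev TestFunction (d : ℕ) : Type := {f : Euc d → ℝ // Continuous f ∧ HasCompactSupport f}

/-- The family of all pairings of a discrete measure with test functions. -/
noncomputable def pairings (η : DiscreteMeasure d) (f : TestFunction d) : ℝ :=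
  ∫ x, f.1 x ∂η.toMeasure

theorem measurable_pairings : Measurable (pairings (d := d)) :=
  measurable_pi_lambda _ fun f => measurable_integral f.2.1 f.2.2

/-- Pairings with test functions already generate the `σ`-algebra, so a law on the cone can be
recovered from its image on a product of real lines. -/
theorem measurableSpace_le_comap_pairings :
    (instMeasurableSpace : MeasurableSpace (DiscreteMeasure d)) ≤
      MeasurableSpace.comap pairings MeasurableSpace.pi := by
  refine iSup_le fun Λ => iSup_le fun hΛ => iSup_le fun hb => ?_
  rw [← measurable_iff_comap_le]
  refine @measurable_apply_of_measurable_integral _ _ (MeasurableSpace.comap pairings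
    MeasurableSpace.pi) _ _ _ _ (fun η : DiscreteMeasure d => η.toMeasure)
    (fun η => η.finite_of_isCompact) (fun f hf hc => ?_) Λ hΛ hb
  exact (measurable_pi_apply (X := fun _ : TestFunction d => ℝ) ⟨f, hf, hc⟩).comp
    (@comap_measurable _ _ MeasurableSpace.pi pairings)

/-- A finite measure on the cone of discrete measures is determined by its Fourier transform. -/
theorem ext_of_fourier {μ ν : Measure (DiscreteMeasure d)} [IsFiniteMeasure μ] [IsFiniteMeasure ν]
    (h : ∀ f : Euc d → ℝ, Continuous f → HasCompactSupport f →
      ∫ η, Complex.exp (Complex.I * ((∫ x, f x ∂η.toMeasure : ℝ) : ℂ)) ∂μ =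
      ∫ η, Complex.exp (Complex.I * ((∫ x, f x ∂η.toMeasure : ℝ) : ℂ)) ∂ν) : μ = ν := by
  classical
  have hmap : μ.map pairings = ν.map pairings := by
    -- It is enough to compare finite-dimensional marginals, by their characteristic functions. A
    -- linear functional of finitely many pairings is the pairing with one linear combination of
    -- test functions, which is again a test function.
    refine IsProjectiveLimit.unique
      (P := fun J : Finset (TestFunction d) => (μ.map pairings).map J.restrict)
      (fun J => rfl) fun J => ?_
    refine Measure.ext_of_charFunDual ?_
    funext L
    have hm : ∀ ρ : Measure (DiscreteMeasure d), charFunDual ((ρ.map pairings).map J.restrict) L =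
        ∫ η, Complex.exp (Complex.I * ((∫ x, (∑ j : J, L (Pi.single j 1) * (j : TestFunction d).1 x)
          ∂η.toMeasure : ℝ) : ℂ)) ∂ρ := by
      intro ρ
      rw [charFunDual_apply, Measure.map_map (Finset.measurable_restrict J) measurable_pairings,
        integral_map ((Finset.measurable_restrict J).comp measurable_pairings).aemeasurable
        (by fun_prop)]
      congr 1 with η
      rw [mul_comm Complex.I]
      congr 3
      have hL : ∀ v : J → ℝ, L v = ∑ j : J, L (Pi.single j 1) * v j := by
        intro v
        refine (L.toLinearMap.pi_apply_eq_sum_univ v).trans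
          (Finset.sum_congr rfl fun j _ => ?_)
        rw [smul_eq_mul, mul_comm]
        exact congrArg (fun w => L w * v j) (funext fun i => by simp [Pi.single_apply, eq_comm])
      refine (hL _).trans ?_
      refine Eq.trans ?_ (integral_finsetSum Finset.univ fun (j : J) _ =>
        ((η.integrable_of_hasCompactSupport
          (j : TestFunction d).2.1 (j : TestFunction d).2.2).const_mul (L (Pi.single j 1)))).symm
      simp only [integral_const_mul]
      rfl
    rw [hm μ, hm ν]
    refine Eq.symm <| h (fun x => ∑ j : J, L (Pi.single j 1) * (j : TestFunction d).1 x)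
      (continuous_finsetSum _ fun j _ =>
        (continuous_const (y := L (Pi.single j 1))).mul (j : TestFunction d).2.1) ?_
    refine HasCompactSupport.intro (K := ⋃ j : J, tsupport (j : TestFunction d).1)
      (isCompact_iUnion fun j => (j : TestFunction d).2.2.isCompact) fun x hx => ?_
    refine Finset.sum_eq_zero fun j _ => ?_
    rw [image_eq_zero_of_notMem_tsupport fun hj => hx (Set.mem_iUnion.2 ⟨j, hj⟩), mul_zero]
  ext s hs
  obtain ⟨t, ht, rfl⟩ := measurableSpace_le_comap_pairings s hs
  rw [← Measure.map_apply measurable_pairings ht, hmap, Measure.map_apply measurable_pairings ht]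

end DiscreteMeasure

/-! ### Refining countable partitions separate points -/

namespace MeasurableSpace

variable {X : Type*} [MeasurableSpace X] [CountablyGenerated X]

/-- A cell of level `n` is a union of cells of level `n + 1`, so a common finer cell forces a common
coarser one. -/
theorem countablePartitionSet_eq_of_succ {n : ℕ} {x y : X}
    (h : countablePartitionSet (n + 1) x = countablePartitionSet (n + 1) y) :
    countablePartitionSet n x = countablePartitionSet n y := by
  have hm := measurableSet_succ_countablePartition n (countablePartitionSet_mem n x)
  obtain ⟨S, hS, hSe⟩ := (measurableSet_generateFrom_countablePartition_iff _ _).1 hm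
  have hx : x ∈ ⋃₀ (S : Set (Set X)) := hSe ▸ mem_countablePartitionSet n x
  obtain ⟨D, hDS, hxD⟩ := hx
  have hD := countablePartitionSet_of_mem (hS hDS) hxD
  have hy : y ∈ D := by
    rw [← hD, h]; exact mem_countablePartitionSet _ _
  have : y ∈ countablePartitionSet n x := by
    rw [hSe]; exact ⟨D, hDS, hy⟩
  exact (countablePartitionSet_of_mem (countablePartitionSet_mem n x) this).symm

theorem countablePartitionSet_eq_of_le {n k : ℕ} (hnk : n ≤ k) {x y : X}
    (h : countablePartitionSet k x = countablePartitionSet k y) :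
    countablePartitionSet n x = countablePartitionSet n y := by
  induction k, hnk using Nat.le_induction with
  | base => exact h
  | succ k _ ih => exact ih (countablePartitionSet_eq_of_succ h)

/-- Otherwise `x` and `y` would belong to the same cells at every level, and these cells generate a
point-separating `σ`-algebra. -/
theorem exists_countablePartitionSet_ne [SeparatesPoints X] {x y : X} (hxy : x ≠ y) :
    ∃ n, countablePartitionSet n x ≠ countablePartitionSet n y := by
  by_contra! h
  have hsep : @SeparatesPoints X (generateFrom (⋃ n, countablePartition X n)) := by
    rw [generateFrom_iUnion_countablePartition]; assumption
  refine hxy (separating_of_generateFrom _ (h := hsep) x y fun s hs => ?_)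
  obtain ⟨n, hn⟩ := Set.mem_iUnion.1 hs
  constructor
  · intro hx
    rw [← countablePartitionSet_of_mem hn hx, h n]; exact mem_countablePartitionSet _ _
  · intro hy
    rw [← countablePartitionSet_of_mem hn hy, ← h n]; exact mem_countablePartitionSet _ _

theorem eventually_injOn_countablePartitionSet [SeparatesPoints X] (F : Finset X) :
    ∀ᶠ n in Filter.atTop, Set.InjOn (countablePartitionSet (α := X) n) F := by
  have h : ∀ x ∈ F, ∀ y ∈ F, ∀ᶠ n in Filter.atTop,
      countablePartitionSet n x = countablePartitionSet n y → x = y := by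
    intro x _ y _
    by_cases hxy : x = y
    · exact Filter.Eventually.of_forall fun _ _ => hxy
    · obtain ⟨n, hn⟩ := exists_countablePartitionSet_ne hxy
      filter_upwards [Filter.eventually_ge_atTop n] with k hk he
      exact absurd (countablePartitionSet_eq_of_le hk he) hn
  have h' := (Filter.eventually_all_finset F).2 fun x hx =>
    (Filter.eventually_all_finset F).2 (h x hx)
  filter_upwards [h'] with n hn x hx y hy using hn x hx y hy

end MeasurableSpace

/-! ### Atoms and their weights as measurable functions of `η` -/

namespace DiscreteMeasure

variable {d : ℕ}

/-- Weights in a representation of `η` are strictly positive, so null measurable sets are those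
disjoint from its index set `S`; testing singletons identifies `S` with `η.atoms`. -/
theorem atoms_spec (η : DiscreteMeasure d) :
    η.atoms.Countable ∧ η.toMeasure η.atomsᶜ = 0 := by
  obtain ⟨S, s, hS, hs, h⟩ := η.discrete
  have happ : ∀ A, MeasurableSet A → (η.toMeasure A = 0 ↔ Disjoint S A) := by
    intro A hA
    rw [h, Measure.sum_apply_eq_zero' hA, Set.disjoint_left]
    have : ∀ x : S, (ENNReal.ofReal (s x) • Measure.dirac (x : Euc d)) A = 0 ↔ (x : Euc d) ∉ A := by
      intro x
      have h0 := not_le.2 (hs x x.2)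
      by_cases hx : (x : Euc d) ∈ A <;> simp [Measure.dirac_apply' _ hA, hx, h0]
    simp only [this, Subtype.forall]
  have hatoms : η.atoms = S := by
    ext x
    simp [atoms, happ _ (measurableSet_singleton x)]
  exact hatoms.symm ▸ ⟨hS, (happ _ hS.measurableSet.compl).2 disjoint_compl_right⟩

theorem apply_eq_zero_iff (η : DiscreteMeasure d) {A : Set (Euc d)} :
    η.toMeasure A = 0 ↔ Disjoint η.atoms A := by
  constructor
  · intro h
    rw [Set.disjoint_left]
    exact fun x hx hxA => hx (measure_mono_null (Set.singleton_subset_iff.2 hxA) h)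
  · intro h
    exact measure_mono_null h.subset_compl_left η.atoms_spec.2

theorem apply_eq_apply_singleton (η : DiscreteMeasure d) {A : Set (Euc d)} {x : Euc d}
    (hx : x ∈ A) (h : ∀ y ∈ η.atoms, y ∈ A → y = x) :
    η.toMeasure A = η.toMeasure {x} := by
  refine le_antisymm ?_ (measure_mono (Set.singleton_subset_iff.2 hx))
  have h0 : η.toMeasure (A \ {x}) = 0 := η.apply_eq_zero_iff.2
    (Set.disjoint_left.2 fun y hy hyA => hyA.2 (h y hy hyA.1))
  calc η.toMeasure A ≤ η.toMeasure (A \ {x} ∪ {x}) := measure_mono (by simp)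
    _ ≤ η.toMeasure (A \ {x}) + η.toMeasure {x} := measure_union_le _ _
    _ = η.toMeasure {x} := by rw [h0, zero_add]

/-- The sum of `h (η (C ∩ B))` over the cells `C` of the `n`-th partition of the space. -/
noncomputable def cellSum (B : Set (Euc d)) (h : ℝ≥0∞ → ℝ≥0∞) (n : ℕ)
    (η : DiscreteMeasure d) : ℝ≥0∞ :=
  ∑ C ∈ (MeasurableSpace.finite_countablePartition (Euc d) n).toFinset, h (η.toMeasure (C ∩ B))

theorem measurable_cellSum {B : Set (Euc d)} (hB : MeasurableSet B) (hb : Bornology.IsBounded B)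
    {h : ℝ≥0∞ → ℝ≥0∞} (hh : Measurable h) (n : ℕ) : Measurable (cellSum B h n) := by
  refine Finset.measurable_fun_sum _ fun C hC => hh.comp (measurable_apply ?_ ?_)
  · exact (MeasurableSpace.measurableSet_countablePartition n (by simpa using hC)).inter hB
  · exact hb.subset Set.inter_subset_right

/-- Once the cells separate the atoms in `B`, an occupied cell has the mass of its single atom, and
empty cells contribute `h 0 = 0`. Sums over atoms thereby become limits of functions of finitely
many masses. -/
theorem eventually_cellSum_eq (η : DiscreteMeasure d) {B : Set (Euc d)}
    (hF : (η.atoms ∩ B).Finite) {h : ℝ≥0∞ → ℝ≥0∞} (h0 : h 0 = 0) :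
    ∀ᶠ n in Filter.atTop, cellSum B h n η = ∑ x ∈ hF.toFinset, h (η.toMeasure {x}) := by
  filter_upwards [MeasurableSpace.eventually_injOn_countablePartitionSet hF.toFinset] with n hn
  refine (Finset.sum_of_injOn (MeasurableSpace.countablePartitionSet n) hn ?_ ?_ ?_).symm
  · intro x _
    simpa using MeasurableSpace.countablePartitionSet_mem n x
  · intro C hC hCF
    rw [η.apply_eq_zero_iff.2, h0]
    rw [Set.disjoint_left]
    rintro x hx ⟨hxC, hxB⟩
    refine hCF ⟨x, by simpa using ⟨hx, hxB⟩, ?_⟩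
    exact MeasurableSpace.countablePartitionSet_of_mem (by simpa using hC) hxC
  · intro x hx
    have hx' : x ∈ η.atoms ∩ B := by simpa using hx
    rw [η.apply_eq_apply_singleton (A := MeasurableSpace.countablePartitionSet n x ∩ B) (x := x)
      ⟨MeasurableSpace.mem_countablePartitionSet n x, hx'.2⟩]
    rintro y hy ⟨hyC, hyB⟩
    refine hn (by simpa using ⟨hy, hyB⟩) hx ?_
    exact MeasurableSpace.countablePartitionSet_of_mem
      (MeasurableSpace.countablePartitionSet_mem n x) hyC

/-- With the indicator of nonzero mass, `cellSum` counts occupied cells. The right side is a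
countable combination of measurable conditions, which makes local finiteness a measurable property.
-/
theorem finite_atoms_inter_iff (η : DiscreteMeasure d) {B : Set (Euc d)} :
    (η.atoms ∩ B).Finite ↔
      ∃ c n₀ : ℕ, ∀ n ≥ n₀, cellSum B (({0}ᶜ : Set ℝ≥0∞).indicator 1) n η ≤ c := by
  classical
  set h : ℝ≥0∞ → ℝ≥0∞ := ({0}ᶜ : Set ℝ≥0∞).indicator 1 with hh
  have h0 : h 0 = 0 := by simp [hh]
  have h1 : ∀ t, t ≠ 0 → h t = 1 := fun t ht => by simp [hh, ht]
  have hle : ∀ t, h t ≤ 1 := fun t => Set.indicator_le_self' (by simp) t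
  constructor
  · intro hF
    obtain ⟨n₀, hn₀⟩ := Filter.eventually_atTop.1 (η.eventually_cellSum_eq hF h0)
    refine ⟨hF.toFinset.card, n₀, fun n hn => ?_⟩
    rw [hn₀ n hn]
    simpa using Finset.sum_le_card_nsmul hF.toFinset _ 1 fun x _ => hle _
  · rintro ⟨c, n₀, hc⟩
    by_contra hinf
    -- At a fine enough level, `c + 1` atoms occupy `c + 1` distinct cells, exceeding the bound `c`.
    obtain ⟨F, hF, hcard⟩ := Set.Infinite.exists_subset_card_eq hinf (c + 1)
    obtain ⟨n, hn, hinj⟩ := ((Filter.eventually_ge_atTop n₀).and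
      (MeasurableSpace.eventually_injOn_countablePartitionSet F)).exists
    have hle' : ((c + 1 : ℕ) : ℝ≥0∞) ≤ c := by
      refine le_trans ?_ (hc n hn)
      calc ((c + 1 : ℕ) : ℝ≥0∞) = ∑ x ∈ F, h (η.toMeasure
              (MeasurableSpace.countablePartitionSet n x ∩ B)) := by
            rw [Finset.sum_congr rfl fun x hx => h1 _ ?_, Finset.sum_const, hcard]
            · simp
            · rw [Ne, η.apply_eq_zero_iff, Set.not_disjoint_iff]
              exact ⟨x, (hF hx).1, MeasurableSpace.mem_countablePartitionSet n x, (hF hx).2⟩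
        _ = ∑ C ∈ F.image (MeasurableSpace.countablePartitionSet n),
              h (η.toMeasure (C ∩ B)) := (Finset.sum_image
              (f := fun C => h (η.toMeasure (C ∩ B))) hinj).symm
        _ ≤ _ := Finset.sum_le_sum_of_subset fun C hC => by
            obtain ⟨x, _, rfl⟩ := Finset.mem_image.1 hC
            simpa using MeasurableSpace.countablePartitionSet_mem n x
    norm_cast at hle'
    omega

/-- Discrete measures whose set of atoms is locally finite. -/
def IsLocallyFinite (η : DiscreteMeasure d) : Prop :=
  ∀ r : ℕ, (η.atoms ∩ Metric.ball 0 r).Finite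

theorem measurableSet_isLocallyFinite :
    MeasurableSet {η : DiscreteMeasure d | η.IsLocallyFinite} := by
  simp only [IsLocallyFinite, finite_atoms_inter_iff, Set.ofPred_forall, Set.ofPred_exists]
  refine MeasurableSet.iInter fun r => MeasurableSet.iUnion fun c => MeasurableSet.iUnion fun n₀ =>
    MeasurableSet.iInter fun n => MeasurableSet.iInter fun _ => ?_
  exact measurableSet_le (measurable_cellSum measurableSet_ball Metric.isBounded_ball
    (measurable_one.indicator (measurableSet_singleton 0).compl) n) measurable_const

/-- The marked point `(x, s_x)` of an atom `x`. -/
noncomputable def markedAtom (η : DiscreteMeasure d) (x : η.atoms) : Euc d × PosReal :=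
  (x, η.weight x)

open Classical in
/-- The counting measure of the marked atoms `(x, s_x)` with `‖x‖ < r`, if the atoms are locally
finite. -/
noncomputable def ballMarks (r : ℕ) (η : DiscreteMeasure d) : Measure (Euc d × PosReal) :=
  if η.IsLocallyFinite then
    Measure.sum fun x : ↥(η.atoms ∩ Metric.ball 0 r) => Measure.dirac (η.markedAtom ⟨x, x.2.1⟩)
  else 0

/-- The default value `0` makes this hold for every `η`, as the `π`-system argument of
`measurable_ballMarks` requires. -/
instance (r : ℕ) (η : DiscreteMeasure d) : IsFiniteMeasure (η.ballMarks r) := by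
  unfold ballMarks
  split_ifs with h
  · have := (h r).to_subtype
    have := Fintype.ofFinite ↥(η.atoms ∩ Metric.ball 0 r)
    rw [Measure.sum_fintype]
    infer_instance
  · infer_instance

/-- Puts the mass of a rectangle in the form that `eventually_cellSum_eq` approximates: a function
of the mass, vanishing at `0`, summed over the atoms. -/
theorem ballMarks_prod {η : DiscreteMeasure d} (hη : η.IsLocallyFinite) (r : ℕ)
    {s : Set (Euc d)} (hs : MeasurableSet s) {t : Set PosReal} (ht : MeasurableSet t)
    (hF : (η.atoms ∩ (Metric.ball 0 r ∩ s)).Finite) :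
    η.ballMarks r (s ×ˢ t) = ∑ x ∈ hF.toFinset,
      (ENNReal.toReal ⁻¹' (Subtype.val '' t)).indicator 1 (η.toMeasure {x}) := by
  rw [ballMarks, if_pos hη, Measure.sum_apply _ (hs.prod ht), sum_eq_tsum_indicator,
    hF.coe_toFinset, ← Set.inter_assoc, ← Set.indicator_indicator, ← tsum_subtype]
  refine tsum_congr fun x => ?_
  rw [Measure.dirac_apply' _ (hs.prod ht)]
  have hw : η.weight ⟨x, x.2.1⟩ ∈ t ↔ (η.toMeasure {(x : Euc d)}).toReal ∈ Subtype.val '' t := by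
    constructor
    · exact fun h => ⟨_, h, rfl⟩
    · rintro ⟨w, hw, he⟩
      have : w = η.weight ⟨x, x.2.1⟩ := Subtype.ext he
      exact this ▸ hw
  by_cases hx : (x : Euc d) ∈ s <;>
    by_cases hxt : η.weight ⟨x, x.2.1⟩ ∈ t <;>
    simp [markedAtom, hx, hxt, Set.indicator, ← hw]

theorem measurable_ballMarks_prod (r : ℕ) {s : Set (Euc d)} (hs : MeasurableSet s)
    {t : Set PosReal} (ht : MeasurableSet t) :
    Measurable fun η : DiscreteMeasure d => η.ballMarks r (s ×ˢ t) := by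
  set h : ℝ≥0∞ → ℝ≥0∞ := (ENNReal.toReal ⁻¹' (Subtype.val '' t)).indicator 1 with hh
  have hm : Measurable h := measurable_one.indicator
    (ENNReal.measurable_toReal (measurableSet_Ioi.subtype_image ht))
  have h0 : h 0 = 0 := by simp [hh]
  refine measurable_of_tendsto_metrizable (f := fun n => {η : DiscreteMeasure d |
    η.IsLocallyFinite}.indicator (cellSum (Metric.ball 0 r ∩ s) h n)) (fun n => ?_) ?_
  · exact (measurable_cellSum (measurableSet_ball.inter hs)
      (Metric.isBounded_ball.subset Set.inter_subset_left) hm n).indicator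
      measurableSet_isLocallyFinite
  · rw [tendsto_pi_nhds]
    intro η
    by_cases hη : η.IsLocallyFinite
    · have hF : (η.atoms ∩ (Metric.ball 0 r ∩ s)).Finite :=
        (hη r).subset (Set.inter_subset_inter_right _ Set.inter_subset_left)
      refine Filter.Tendsto.congr' (Filter.EventuallyEq.symm ?_) tendsto_const_nhds
      filter_upwards [η.eventually_cellSum_eq hF h0] with n hn
      rw [Set.indicator_of_mem (by exact hη), hn, ballMarks_prod hη r hs ht hF]
    · have : ∀ n, {η : DiscreteMeasure d | η.IsLocallyFinite}.indicator
          (cellSum (Metric.ball 0 r ∩ s) h n) η = 0 := fun n =>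
        Set.indicator_of_notMem (by exact hη) _
      simp [ballMarks, hη]

theorem measurable_ballMarks (r : ℕ) : Measurable (ballMarks (d := d) r) := by
  refine Measurable.measure_of_isPiSystem generateFrom_prod.symm isPiSystem_prod ?_ ?_
  · rintro _ ⟨s, hs, t, ht, rfl⟩
    exact measurable_ballMarks_prod r hs ht
  · rw [← Set.univ_prod_univ]
    exact measurable_ballMarks_prod r MeasurableSet.univ MeasurableSet.univ

theorem measurable_integral_ballMarks (r : ℕ) {w : Euc d × PosReal → ℝ} (hw : Measurable w) :
    Measurable fun η : DiscreteMeasure d => ∫ p, w p ∂η.ballMarks r :=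
  (StronglyMeasurable.integral_kernel (κ := (⟨_, measurable_ballMarks r⟩ :
    Kernel (DiscreteMeasure d) (Euc d × PosReal))) hw.stronglyMeasurable).measurable

theorem integral_ballMarks {η : DiscreteMeasure d} (hη : η.IsLocallyFinite) (r : ℕ)
    [Fintype ↥(η.atoms ∩ Metric.ball 0 r)] {w : Euc d × PosReal → ℝ} (hw : Measurable w) :
    ∫ p, w p ∂η.ballMarks r =
      ∑ x : ↥(η.atoms ∩ Metric.ball 0 r), w (η.markedAtom ⟨x, x.2.1⟩) := by
  rw [ballMarks, if_pos hη, Measure.sum_fintype, integral_finsetSum_measure]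
  · exact Finset.sum_congr rfl fun x _ => integral_dirac' _ _ hw.stronglyMeasurable
  · exact fun x _ => integrable_dirac' hw.stronglyMeasurable (by simp)

theorem ballMarks_eq_zero_iff {η : DiscreteMeasure d} (hη : η.IsLocallyFinite) (r : ℕ)
    {Z : Set (Euc d × PosReal)} (hZ : MeasurableSet Z) :
    η.ballMarks r Z = 0 ↔
      ∀ x : η.atoms, (x : Euc d) ∈ Metric.ball 0 r → η.markedAtom x ∉ Z := by
  rw [ballMarks, if_pos hη, Measure.sum_apply_eq_zero' hZ]
  simp only [Measure.dirac_apply' _ hZ, Set.indicator_apply_eq_zero, Pi.one_apply, one_ne_zero,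
    imp_false]
  exact ⟨fun h x hx => h ⟨x, x.2, hx⟩, fun h x => h ⟨x, x.2.1⟩ x.2.2⟩

end DiscreteMeasure

/-! ### Finite Poisson configurations and the exponential formula -/

section Configuration

variable {E : Type*} [MeasurableSpace E]

/-- Finite configurations of points, listed in some order. -/
abbrev Configuration (E : Type*) : Type _ := Σ n : ℕ, (Fin n → E)

/-- The configuration of a list of `n` points. -/
abbrev Configuration.ofFn (n : ℕ) (x : Fin n → E) : Configuration E := ⟨n, x⟩

theorem measurableSet_configuration_iff {s : Set (Configuration E)} :
    MeasurableSet s ↔ ∀ n, MeasurableSet (Configuration.ofFn n ⁻¹' s) := by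
  simp only [MeasurableSpace.measurableSet_iInf,
    MeasurableSpace.map_def]

theorem measurable_configuration {β : Type*} [MeasurableSpace β] {f : Configuration E → β}
    (h : ∀ n, Measurable fun x : Fin n → E => f ⟨n, x⟩) : Measurable f := by
  intro s hs
  rw [measurableSet_configuration_iff]
  exact fun n => h n hs

theorem measurable_sigmaMk (n : ℕ) : Measurable (Configuration.ofFn (E := E) n) :=
  fun _ hs => measurableSet_configuration_iff.1 hs n

omit [MeasurableSpace E] in
theorem Configuration.ofFn_injective (n : ℕ) : Function.Injective (Configuration.ofFn (E := E) n) :=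
  fun _ _ h => eq_of_heq (Sigma.mk.inj h).2

theorem measurableEmbedding_sigmaMk (n : ℕ) :
    MeasurableEmbedding (Configuration.ofFn (E := E) n) where
  injective := Configuration.ofFn_injective n
  measurable := measurable_sigmaMk n
  measurableSet_image' := by
    intro s hs
    rw [measurableSet_configuration_iff]
    intro k
    by_cases hk : k = n
    · subst hk
      rwa [Set.preimage_image_eq _ (Configuration.ofFn_injective _)]
    · convert MeasurableSet.empty
      rw [Set.eq_empty_iff_forall_notMem]
      rintro x ⟨y, _, hy⟩
      exact hk (congrArg Sigma.fst hy).symm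

/-- The law of a Poisson configuration with finite intensity measure `ν`. -/
noncomputable def poissonConfig (ν : Measure E) : Measure (Configuration E) :=
  Measure.sum fun n : ℕ => ENNReal.ofReal (Real.exp (-ν.real Set.univ) / n.factorial) •
    (Measure.pi fun _ : Fin n => ν).map (Configuration.ofFn n)

/-- The product measure is not normalised, so the `n`-point part has mass `e^{-ν(E)} ν(E)^n / n!`;
the exponential series sums these to `1`. -/
instance (ν : Measure E) [IsFiniteMeasure ν] : IsProbabilityMeasure (poissonConfig ν) := by
  constructor
  rw [poissonConfig, Measure.sum_apply _ MeasurableSet.univ]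
  have h : ∀ n : ℕ, (ENNReal.ofReal (Real.exp (-ν.real Set.univ) / n.factorial) •
      (Measure.pi fun _ : Fin n => ν).map (Configuration.ofFn n)) (Set.univ : Set (Configuration E)) =
      ENNReal.ofReal (Real.exp (-ν.real Set.univ) * (ν.real Set.univ ^ n / n.factorial)) := by
    intro n
    rw [Measure.smul_apply, Measure.map_apply (measurable_sigmaMk n) MeasurableSet.univ,
      Set.preimage_univ, Measure.pi_univ, Finset.prod_const, Finset.card_univ, Fintype.card_fin,
      smul_eq_mul, ← ofReal_measureReal, ← ENNReal.ofReal_pow measureReal_nonneg,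
      ← ENNReal.ofReal_mul (by positivity)]
    congr 1
    ring
  have hs := (NormedSpace.expSeries_div_hasSum_exp (𝔸 := ℝ) (ν.real Set.univ)).mul_left
    (Real.exp (-ν.real Set.univ))
  simp_rw [h]
  rw [← ENNReal.ofReal_tsum_of_nonneg (fun n => by positivity) hs.summable, hs.tsum_eq,
    ← Real.exp_eq_exp_ℝ, ← Real.exp_add]
  simp

theorem ae_poissonConfig_of_forall (ν : Measure E) {p : Configuration E → Prop}
    (h : ∀ n, ∀ᵐ x ∂Measure.pi (fun _ : Fin n => ν), p ⟨n, x⟩) : ∀ᵐ ω ∂poissonConfig ν, p ω := by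
  rw [poissonConfig, Measure.ae_sum_iff]
  intro n
  refine Measure.ae_smul_measure ?_ _
  exact (measurableEmbedding_sigmaMk n).ae_map_iff.2 (h n)

variable {ν : Measure E} [IsFiniteMeasure ν]

theorem ae_poissonConfig_forall {q : E → Prop} (h : ∀ᵐ p ∂ν, q p) :
    ∀ᵐ ω ∂poissonConfig ν, ∀ i, q (ω.2 i) := by
  refine ae_poissonConfig_of_forall ν fun n => ?_
  exact ae_all_iff.2 fun i => (Measure.tendsto_eval_ae_ae (μ := fun _ : Fin n => ν) (i := i)).eventually h

/-- By Fubini: with the other points fixed, the `i`-th point would have to lie in the null fibre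
over the location of the `j`-th. -/
theorem ae_pi_fst_ne {X Y : Type*} [MeasurableSpace X] [MeasurableSpace Y]
    [MeasurableEq X] {ν : Measure (X × Y)} [IsFiniteMeasure ν]
    (h : ∀ x, ν (Prod.fst ⁻¹' {x}) = 0) (n : ℕ) {i j : Fin n} (hij : i ≠ j) :
    ∀ᵐ p ∂Measure.pi (fun _ : Fin n => ν), (p i).1 ≠ (p j).1 := by
  obtain _ | n := n
  · exact i.elim0
  obtain ⟨k, rfl⟩ := Fin.exists_succAbove_eq hij.symm
  have hmp := measurePreserving_piFinSuccAbove (fun _ : Fin (n + 1) => ν) i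
  have hae : ∀ᵐ q ∂(ν.prod (Measure.pi fun _ : Fin n => ν)), q.1.1 ≠ (q.2 k).1 := by
    have hms : MeasurableSet {q : (X × Y) × (Fin n → X × Y) | q.1.1 ≠ (q.2 k).1} :=
      (measurableSet_eq_fun (by fun_prop) (by fun_prop)).compl
    have hz : (ν.prod (Measure.pi fun _ : Fin n => ν))
        {q : (X × Y) × (Fin n → X × Y) | q.1.1 ≠ (q.2 k).1}ᶜ = 0 := by
      rw [Measure.prod_apply_symm hms.compl]
      simp only [Set.preimage_compl]
      refine (lintegral_congr fun q => ?_).trans lintegral_zero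
      rw [← h (q k).1]
      congr 1
      ext p
      simp
    exact hz
  have := hmp.quasiMeasurePreserving.ae hae
  filter_upwards [this] with p hp
  simpa [MeasurableEquiv.piFinSuccAbove, Fin.insertNthEquiv, Fin.removeNth] using hp

theorem ae_poissonConfig_injective {X Y : Type*} [MeasurableSpace X] [MeasurableSpace Y]
    [MeasurableEq X] {ν : Measure (X × Y)} [IsFiniteMeasure ν]
    (h : ∀ x, ν (Prod.fst ⁻¹' {x}) = 0) :
    ∀ᵐ ω ∂poissonConfig ν, Function.Injective fun i => (ω.2 i).1 := by
  refine ae_poissonConfig_of_forall ν fun n => ?_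
  have : ∀ᵐ p ∂Measure.pi (fun _ : Fin n => ν), ∀ i j, i ≠ j → (p i).1 ≠ (p j).1 := by
    simp only [ae_all_iff]
    exact fun i j hij => ae_pi_fst_ne h n hij
  filter_upwards [this] with p hp i j hij
  by_contra hne
  exact hp i j hne hij

theorem measurable_prod_configuration {u : E → ℂ} (hu : Measurable u) :
    Measurable fun ω : Configuration E => ∏ i, u (ω.2 i) := by
  refine measurable_configuration fun n => ?_
  have h : Measurable fun x : Fin n → E => ∏ i, u (x i) :=
    Finset.measurable_fun_prod _ fun i _ => hu.comp (measurable_pi_apply i)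
  exact h

/-- The `n`-point part contributes `e^{-ν(E)} (∫ u)^n / n!`, and the sum over `n` is `exp (∫ u -
ν(E))`. The same series with `‖u‖` gives integrability. -/
theorem integral_poissonConfig_prod {u : E → ℂ} (hu : Measurable u) (hui : Integrable u ν) :
    ∫ ω, ∏ i, u (ω.2 i) ∂poissonConfig ν = Complex.exp (∫ p, (u p - 1) ∂ν) := by
  have hm := measurable_prod_configuration hu
  have hint : Integrable (fun ω : Configuration E => ∏ i, u (ω.2 i)) (poissonConfig ν) := by
    rw [poissonConfig, integrable_sum_measure_iff]
    constructor
    · intro n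
      refine Integrable.smul_measure ?_ ENNReal.ofReal_ne_top
      rw [(measurableEmbedding_sigmaMk n).integrable_map_iff]
      exact Integrable.fintype_prod (ι := Fin n) (f := fun _ => u) fun _ => hui
    · have hs := (NormedSpace.expSeries_div_hasSum_exp (𝔸 := ℝ) (∫ p, ‖u p‖ ∂ν)).summable.mul_left
        (Real.exp (-ν.real Set.univ))
      refine hs.congr fun n => ?_
      rw [integral_smul_measure, (measurableEmbedding_sigmaMk n).integral_map,
        ENNReal.toReal_ofReal (by positivity)]
      simp only [norm_prod]
      have := integral_fintype_prod_eq_pow (ι := Fin n) (fun p => ‖u p‖) (μ := ν)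
      rw [Fintype.card_fin] at this
      rw [this, smul_eq_mul]
      ring
  rw [poissonConfig] at hint ⊢
  rw [integral_sum_measure hint]
  have hs := (NormedSpace.expSeries_div_hasSum_exp (𝔸 := ℂ) (∫ p, u p ∂ν)).mul_left
        (Complex.exp (-ν.real Set.univ))
  have hc : ∀ n : ℕ, ∫ ω : Configuration E, ∏ i, u (ω.2 i)
      ∂(ENNReal.ofReal (Real.exp (-ν.real Set.univ) / n.factorial) •
        (Measure.pi fun _ : Fin n => ν).map (Configuration.ofFn n)) =
      Complex.exp (-ν.real Set.univ) * ((∫ p, u p ∂ν) ^ n / n.factorial) := by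
    intro n
    rw [integral_smul_measure, (measurableEmbedding_sigmaMk n).integral_map,
        ENNReal.toReal_ofReal (by positivity)]
    have := integral_fintype_prod_eq_pow (ι := Fin n) u (μ := ν)
    rw [Fintype.card_fin] at this
    simp only [Configuration.ofFn]
    rw [this, Complex.real_smul]
    push_cast
    ring
  simp_rw [hc]
  rw [hs.tsum_eq, ← Complex.exp_eq_exp_ℂ, ← Complex.exp_add,
    integral_sub hui (integrable_const _)]
  congr 1
  simp
  ring

theorem integral_infinitePi_poissonConfig_prod {ν : ℕ → Measure E} [∀ k, IsFiniteMeasure (ν k)]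
    {u : E → ℂ} (hu : Measurable u) (K : ℕ) (hui : ∀ k < K, Integrable u (ν k)) :
    ∫ ω, ∏ k ∈ Finset.range K, ∏ i, u ((ω k).2 i)
      ∂Measure.infinitePi (fun k => poissonConfig (ν k)) =
    Complex.exp (∫ p, (u p - 1) ∂(∑ k ∈ Finset.range K, ν k)) := by
  have h := integral_restrict_infinitePi (μ := fun k => poissonConfig (ν k))
    (s := Finset.range K)
    (f := fun x : (k : Finset.range K) → Configuration E => ∏ k, ∏ i, u ((x k).2 i))
    (Finset.measurable_fun_prod _ fun k _ => (measurable_prod_configuration hu).comp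
      (measurable_pi_apply k)).aestronglyMeasurable
  rw [integral_fintype_prod_eq_prod (fun (_ : Finset.range K) (c : Configuration E) =>
    ∏ i, u (c.2 i))] at h
  have hl : ∀ ω : ℕ → Configuration E, ∏ k ∈ Finset.range K, ∏ i, u ((ω k).2 i) =
      ∏ k : Finset.range K, ∏ i, u (((Finset.range K).restrict ω k).2 i) := fun ω =>
    (Finset.prod_coe_sort (Finset.range K) fun k => ∏ i, u ((ω k).2 i)).symm
  simp_rw [hl]
  rw [h, Finset.prod_coe_sort (Finset.range K)
    (fun k => ∫ c : Configuration E, ∏ i, u (c.2 i) ∂poissonConfig (ν k)),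
    Finset.prod_congr rfl fun k hk => integral_poissonConfig_prod hu
      (hui k (Finset.mem_range.1 hk)), ← Complex.exp_sum, integral_finsetSum_measure]
  exact fun k hk => (hui k (Finset.mem_range.1 hk)).sub (integrable_const _)

end Configuration

/-! ### From sequences of configurations to discrete measures -/

theorem hasSum_sigma_fin_of_eq_zero {M : Type*} [AddCommMonoid M] [TopologicalSpace M]
    {n : ℕ → ℕ} {F : (Σ k, Fin (n k)) → M} {K : ℕ} (h : ∀ k i, K ≤ k → F ⟨k, i⟩ = 0) :
    HasSum F (∑ k ∈ Finset.range K, ∑ i, F ⟨k, i⟩) := by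
  rw [← Finset.sum_sigma (Finset.range K) (fun _ => Finset.univ) F]
  refine hasSum_sum_of_ne_finset_zero fun j hj => ?_
  exact h j.1 j.2 (by simpa using hj)

section PointSequence

variable {d : ℕ}

/-- Sequences of finite configurations of marked points. -/
abbrev PointSequence (d : ℕ) : Type := ℕ → Configuration (Euc d × PosReal)

namespace PointSequence

/-- The index set of the points of a sequence of configurations. -/
abbrev Index (ω : PointSequence d) : Type := Σ k, Fin (ω k).1

/-- The point with a given index. -/
abbrev point (ω : PointSequence d) (j : ω.Index) : Euc d × PosReal := (ω j.1).2 j.2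

open Classical in
/-- The contribution of a point of the `k`-th configuration to the sampled measure; points outside
the shell `k ≤ ‖x‖ < k + 1` are discarded. -/
noncomputable def contribution (k : ℕ) (p : Euc d × PosReal) : Measure (Euc d) :=
  if ⌊‖p.1‖⌋₊ = k then ENNReal.ofReal (p.2 : ℝ) • Measure.dirac p.1 else 0

theorem contribution_apply (k : ℕ) (p : Euc d × PosReal) {A : Set (Euc d)}
    (hA : MeasurableSet A) : contribution k p A =
      ({q : Euc d × PosReal | ⌊‖q.1‖⌋₊ = k} ∩ Prod.fst ⁻¹' A).indicator
        (fun q => ENNReal.ofReal (q.2 : ℝ)) p := by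
  unfold contribution
  by_cases h : ⌊‖p.1‖⌋₊ = k <;> by_cases hx : p.1 ∈ A <;>
    simp [Measure.dirac_apply' _ hA, h, hx, Set.indicator]

/-- The measure `∑ s δ_x`, the sum being over the points `(x, s)` that lie in their shell. -/
noncomputable def toMeasure (ω : PointSequence d) : Measure (Euc d) :=
  Measure.sum fun j : ω.Index => contribution j.1 (ω.point j)

/-- Discarding points outside their shell lets a bounded set see only finitely many configurations
for every `ω`, so the sampled measure is Radon everywhere and not just almost surely. -/
theorem toMeasure_apply (ω : PointSequence d) {K : ℕ} {A : Set (Euc d)} (hA : MeasurableSet A)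
    (hAK : A ⊆ Metric.ball 0 K) :
    ω.toMeasure A = ∑ k ∈ Finset.range K, ∑ i, contribution k ((ω k).2 i) A := by
  rw [toMeasure, Measure.sum_apply _ hA]
  refine (hasSum_sigma_fin_of_eq_zero fun k i hk => ?_).tsum_eq
  rw [contribution_apply _ _ hA, Set.indicator_of_notMem]
  rintro ⟨h1, h2⟩
  have h3 := hAK h2
  rw [mem_ball_zero_iff, ← Nat.floor_lt (norm_nonneg _)] at h3
  exact absurd (lt_of_eq_of_lt (Eq.symm h1) h3) (not_lt.2 hk)

theorem exists_subset_ball {Λ : Set (Euc d)} (hb : Bornology.IsBounded Λ) :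
    ∃ K : ℕ, Λ ⊆ Metric.ball 0 K := by
  obtain ⟨r, hr⟩ := hb.subset_ball 0
  obtain ⟨K, hK⟩ := exists_nat_ge r
  exact ⟨K, hr.trans (Metric.ball_subset_ball hK)⟩

theorem toMeasure_lt_top (ω : PointSequence d) {C : Set (Euc d)} (hC : IsCompact C) :
    ω.toMeasure C < ∞ := by
  obtain ⟨K, hK⟩ := exists_subset_ball hC.isBounded
  rw [ω.toMeasure_apply hC.measurableSet hK]
  refine ENNReal.sum_lt_top.2 fun k _ => ENNReal.sum_lt_top.2 fun i _ => ?_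
  rw [contribution_apply _ _ hC.measurableSet]
  exact (Set.indicator_le_self _ _ _).trans_lt ENNReal.ofReal_lt_top

/-- The discrete Radon measure `∑ s δ_x`, the sum being over the points `(x, s)` that lie in their
shell. -/
noncomputable def toDiscreteMeasure (ω : PointSequence d) : DiscreteMeasure d where
  toMeasure := ω.toMeasure
  finite_of_isCompact _ hC := ω.toMeasure_lt_top hC
  discrete := by
    have hfin : ∀ x, ω.toMeasure {x} ≠ ∞ := fun x => (ω.toMeasure_lt_top isCompact_singleton).ne
    -- Different indices may share a location when `ω` is arbitrary, so the weights are taken to be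
    -- the total masses of singletons.
    set S : Set (Euc d) := {x | ω.toMeasure {x} ≠ 0} with hS
    have hD : (Set.range fun j => (ω.point j).1).Countable := Set.countable_range _
    have hSD : S ⊆ Set.range fun j => (ω.point j).1 := by
      intro x hx
      by_contra hx'
      refine hx ?_
      rw [toMeasure, Measure.sum_apply_eq_zero' (measurableSet_singleton x)]
      intro j
      rw [contribution_apply _ _ (measurableSet_singleton x), Set.indicator_of_notMem]
      exact fun h => hx' ⟨j, h.2⟩
    have hSc : S.Countable := hD.mono hSD
    have hnull : ω.toMeasure Sᶜ = 0 := by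
      have h1 : ω.toMeasure (Sᶜ ∩ Set.range fun j => (ω.point j).1) = 0 := by
        refine (measure_null_iff_singleton (hD.mono Set.inter_subset_right)).2 fun x hx => ?_
        by_contra h
        exact hx.1 h
      have h2 : ω.toMeasure (Set.range fun j => (ω.point j).1)ᶜ = 0 := by
        rw [toMeasure, Measure.sum_apply_eq_zero' hD.measurableSet.compl]
        intro j
        rw [contribution_apply _ _ hD.measurableSet.compl, Set.indicator_of_notMem]
        exact fun h => h.2 ⟨j, rfl⟩
      refine measure_mono_null (fun x hx => ?_) (measure_union_null h1 h2)
      by_cases hxD : x ∈ Set.range fun j => (ω.point j).1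
      exacts [Or.inl ⟨hx, hxD⟩, Or.inr hxD]
    refine ⟨S, fun x => (ω.toMeasure {x}).toReal, hSc, fun x hx =>
      ENNReal.toReal_pos hx (hfin x), ?_⟩
    have := hSc.to_subtype
    ext A hA
    have hAS : ω.toMeasure A = ω.toMeasure (⋃ x : S, A ∩ {(x : Euc d)}) := by
      rw [← Set.inter_iUnion, Set.iUnion_coe_set, Set.biUnion_of_singleton]
      refine le_antisymm ?_ (measure_mono Set.inter_subset_left)
      rw [← measure_inter_add_sdiff A hSc.measurableSet,
        measure_mono_null (Set.sdiff_subset_compl A S) hnull, add_zero]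
    rw [hAS, measure_iUnion, Measure.sum_apply _ hA]
    · refine tsum_congr fun x => ?_
      rw [ENNReal.ofReal_toReal (hfin _)]
      by_cases hx : (x : Euc d) ∈ A
      · simp [Set.inter_eq_right.2 (Set.singleton_subset_iff.2 hx), hx]
      · simp [Measure.dirac_apply' _ hA, hx]
    · intro x y hxy
      refine Disjoint.mono Set.inter_subset_right Set.inter_subset_right ?_
      simpa using fun h => hxy (Subtype.ext h)
    · exact fun x => hA.inter (measurableSet_singleton _)

theorem measurable_toDiscreteMeasure : Measurable (toDiscreteMeasure (d := d)) := by
  rw [measurable_iff_comap_le]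
  simp only [DiscreteMeasure.instMeasurableSpace, MeasurableSpace.comap_iSup,
    MeasurableSpace.comap_comp]
  refine iSup_le fun Λ => iSup_le fun hΛ => iSup_le fun hb => ?_
  rw [← measurable_iff_comap_le]
  obtain ⟨K, hK⟩ := exists_subset_ball hb
  have he : ((fun η : DiscreteMeasure d => η.toMeasure Λ) ∘ toDiscreteMeasure) =
      fun ω => ∑ k ∈ Finset.range K, ∑ i, contribution k ((ω k).2 i) Λ :=
    funext fun ω => ω.toMeasure_apply hΛ hK
  rw [he]
  refine Finset.measurable_fun_sum _ fun k _ => ?_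
  have hc : Measurable fun p : Euc d × PosReal => contribution k p Λ := by
    simp only [contribution_apply _ _ hΛ]
    refine Measurable.indicator (by fun_prop) (MeasurableSet.inter ?_ (measurable_fst hΛ))
    exact measurableSet_eq_fun (by fun_prop) measurable_const
  have hs : Measurable fun c : Configuration (Euc d × PosReal) =>
      ∑ i, contribution k (c.2 i) Λ := by
    refine measurable_configuration fun n => ?_
    have h : Measurable fun x : Fin n → Euc d × PosReal => ∑ i, contribution k (x i) Λ :=
      Finset.measurable_fun_sum _ fun i _ => hc.comp (measurable_pi_apply i)
    exact h
  exact hs.comp (measurable_pi_apply k)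

/-- The points lie in their shells and have distinct locations. -/
structure IsRegular (ω : PointSequence d) : Prop where
  floor_norm : ∀ j : ω.Index, ⌊‖(ω.point j).1‖⌋₊ = j.1
  injective : Function.Injective fun j : ω.Index => (ω.point j).1

namespace IsRegular

variable {ω : PointSequence d} (hω : ω.IsRegular)
include hω

theorem mem_ball_iff (j : ω.Index) (K : ℕ) : (ω.point j).1 ∈ Metric.ball 0 (K : ℝ) ↔ j.1 < K := by
  rw [mem_ball_zero_iff, ← Nat.floor_lt (norm_nonneg _), hω.floor_norm]

theorem toMeasure_eq : ω.toDiscreteMeasure.toMeasure =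
    Measure.sum fun j : ω.Index =>
      ENNReal.ofReal ((ω.point j).2 : ℝ) • Measure.dirac (ω.point j).1 := by
  show ω.toMeasure = _
  unfold toMeasure
  congr 1
  funext j
  rw [contribution, if_pos (hω.floor_norm j)]

theorem apply_singleton (j : ω.Index) :
    ω.toDiscreteMeasure.toMeasure {(ω.point j).1} = ENNReal.ofReal ((ω.point j).2 : ℝ) := by
  rw [hω.toMeasure_eq, Measure.sum_apply _ (measurableSet_singleton _), tsum_eq_single j]
  · simp
  · intro k hk
    have : (ω.point k).1 ≠ (ω.point j).1 := fun h => hk (hω.injective h)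
    simp [this]

theorem mem_atoms_iff {x : Euc d} :
    x ∈ ω.toDiscreteMeasure.atoms ↔ ∃ j : ω.Index, (ω.point j).1 = x := by
  constructor
  · intro hx
    by_contra! h
    refine hx ?_
    rw [hω.toMeasure_eq, Measure.sum_apply_eq_zero' (measurableSet_singleton _)]
    intro j
    simp [h j]
  · rintro ⟨j, rfl⟩
    show _ ≠ _
    rw [hω.apply_singleton]
    exact (ENNReal.ofReal_pos.2 (ω.point j).2.2).ne'

theorem markedAtom_eq (j : ω.Index) (h : (ω.point j).1 ∈ ω.toDiscreteMeasure.atoms) :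
    ω.toDiscreteMeasure.markedAtom ⟨(ω.point j).1, h⟩ = ω.point j := by
  refine Prod.ext rfl (Subtype.ext ?_)
  show (ω.toDiscreteMeasure.toMeasure {(ω.point j).1}).toReal = _
  rw [hω.apply_singleton, ENNReal.toReal_ofReal (le_of_lt (ω.point j).2.2)]

theorem isLocallyFinite : ω.toDiscreteMeasure.IsLocallyFinite := by
  intro K
  refine ((Finset.sigma (Finset.range K) fun k => (Finset.univ : Finset (Fin (ω k).1))).image
    fun j : ω.Index => (ω.point j).1).finite_toSet.subset ?_
  rintro x ⟨hx, hxK⟩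
  obtain ⟨j, rfl⟩ := hω.mem_atoms_iff.1 hx
  rw [hω.mem_ball_iff] at hxK
  simp only [Finset.coe_image, Set.mem_image, Finset.mem_coe]
  exact ⟨j, by simpa using hxK, rfl⟩

theorem integral_eq {f : Euc d → ℝ} (hf : Continuous f) (hc : HasCompactSupport f) {K : ℕ}
    (hK : tsupport f ⊆ Metric.ball 0 K) :
    ∫ x, f x ∂ω.toDiscreteMeasure.toMeasure =
      ∑ k ∈ Finset.range K, ∑ i, (((ω k).2 i).2 : ℝ) * f ((ω k).2 i).1 := by
  have hint := ω.toDiscreteMeasure.integrable_of_hasCompactSupport hf hc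
  rw [hω.toMeasure_eq] at hint ⊢
  rw [integral_sum_measure hint]
  have h : ∀ j : ω.Index, ∫ x, f x ∂(ENNReal.ofReal ((ω.point j).2 : ℝ) •
      Measure.dirac (ω.point j).1) = ((ω.point j).2 : ℝ) * f (ω.point j).1 := by
    intro j
    rw [integral_smul_measure, integral_dirac, ENNReal.toReal_ofReal (le_of_lt (ω.point j).2.2),
      smul_eq_mul]
  simp_rw [h]
  refine (hasSum_sigma_fin_of_eq_zero fun k i hk => ?_).tsum_eq
  have hx : ((ω k).2 i).1 ∉ tsupport f := fun hx =>
    absurd ((hω.mem_ball_iff ⟨k, i⟩ K).1 (hK hx)) (not_lt.2 hk)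
  exact mul_eq_zero_of_right _ (image_eq_zero_of_notMem_tsupport hx)

/-- Regularity makes the indices correspond bijectively to the atoms. This turns a functional of `η`
into a sum over sampled points, where the exponential formula applies. -/
theorem integral_ballMarks_eq (K : ℕ) {w : Euc d × PosReal → ℝ} (hw : Measurable w) :
    ∫ p, w p ∂ω.toDiscreteMeasure.ballMarks K =
      ∑ k ∈ Finset.range K, ∑ i, w ((ω k).2 i) := by
  have := (hω.isLocallyFinite K).fintype
  rw [DiscreteMeasure.integral_ballMarks hω.isLocallyFinite K hw,
    ← Finset.sum_sigma (Finset.range K) (fun _ => Finset.univ) fun j : ω.Index => w (ω.point j)]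
  symm
  refine Finset.sum_bij (fun j hj => ⟨(ω.point j).1, hω.mem_atoms_iff.2 ⟨j, rfl⟩,
    (hω.mem_ball_iff j K).2 (by simpa using hj)⟩) (fun _ _ => Finset.mem_univ _) ?_ ?_ ?_
  · intro j _ k _ h
    exact hω.injective (congrArg Subtype.val h)
  · rintro ⟨x, hx, hxK⟩ _
    obtain ⟨j, rfl⟩ := hω.mem_atoms_iff.1 hx
    exact ⟨j, by simpa using (hω.mem_ball_iff j K).1 hxK, rfl⟩
  · intro j _
    rw [hω.markedAtom_eq]

end IsRegular

end PointSequence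

/-! ### Independent Poisson configurations on the shells -/

/-- A measure on marked points that is finite over bounded sets of locations. -/
class IsLocallyFiniteLevy (m : Measure (Euc d × PosReal)) : Prop where
  lt_top : ∀ Λ : Set (Euc d), MeasurableSet Λ → Bornology.IsBounded Λ → m (Λ ×ˢ Set.univ) < ∞

/-- The shell `k ≤ ‖x‖ < k + 1`. -/
def shell (d k : ℕ) : Set (Euc d) := {x | ⌊‖x‖⌋₊ = k}

theorem measurableSet_shell (k : ℕ) : MeasurableSet (shell d k) :=
  measurableSet_eq_fun (by fun_prop) measurable_const

theorem shell_subset_ball {k K : ℕ} (h : k < K) : shell d k ⊆ Metric.ball 0 K := by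
  intro x hx
  rw [mem_ball_zero_iff, ← Nat.floor_lt (norm_nonneg _)]
  exact lt_of_eq_of_lt hx h

/-- The restriction of a measure on marked points to a shell. -/
noncomputable def shellMeasure (m : Measure (Euc d × PosReal)) (k : ℕ) :
    Measure (Euc d × PosReal) := m.restrict (shell d k ×ˢ Set.univ)

instance (m : Measure (Euc d × PosReal)) [IsLocallyFiniteLevy m] (k : ℕ) :
    IsFiniteMeasure (shellMeasure m k) :=
  isFiniteMeasure_restrict.2 (IsLocallyFiniteLevy.lt_top _ (measurableSet_shell k)
    (Metric.isBounded_ball.subset (shell_subset_ball k.lt_succ_self))).ne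

theorem sum_shellMeasure (m : Measure (Euc d × PosReal)) (K : ℕ) :
    ∑ k ∈ Finset.range K, shellMeasure m k = m.restrict (Metric.ball 0 K ×ˢ Set.univ) := by
  have h : Metric.ball (0 : Euc d) K ×ˢ (Set.univ : Set PosReal) =
      ⋃ k ∈ Finset.range K, shell d k ×ˢ Set.univ := by
    ext p
    simp [shell, Nat.floor_lt]
  rw [h, Measure.restrict_biUnion_finset]
  · rw [Measure.sum_fintype]
    exact (Finset.sum_coe_sort (Finset.range K) (shellMeasure m)).symm
  · intro k _ l _ hkl
    refine Set.disjoint_left.2 fun p hp hp' => hkl ?_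
    exact (hp.1 : _ = k).symm.trans hp'.1
  · exact fun k => (measurableSet_shell k).prod MeasurableSet.univ

/-- The law of a sequence of independent Poisson configurations, one for each shell. -/
noncomputable def pointSequenceLaw (m : Measure (Euc d × PosReal)) : Measure (PointSequence d) :=
  Measure.infinitePi fun k => poissonConfig (shellMeasure m k)

instance (m : Measure (Euc d × PosReal)) [IsLocallyFiniteLevy m] :
    IsProbabilityMeasure (pointSequenceLaw m) := by
  unfold pointSequenceLaw; infer_instance

theorem ae_pointSequenceLaw_of_forall {m : Measure (Euc d × PosReal)} [IsLocallyFiniteLevy m]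
    {p : ℕ → Configuration (Euc d × PosReal) → Prop}
    (h : ∀ k, ∀ᵐ c ∂poissonConfig (shellMeasure m k), p k c) :
    ∀ᵐ ω ∂pointSequenceLaw m, ∀ k, p k (ω k) :=
  ae_all_iff.2 fun k => (measurePreserving_eval_infinitePi
    (fun k => poissonConfig (shellMeasure m k)) k).quasiMeasurePreserving.ae (h k)

/-- Within a shell, coincidences are null because no fibre is charged; points of different shells
differ in `⌊‖x‖⌋₊`. -/
theorem ae_isRegular {m : Measure (Euc d × PosReal)} [IsLocallyFiniteLevy m]
    (hm : ∀ x : Euc d, m ({x} ×ˢ Set.univ) = 0) :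
    ∀ᵐ ω ∂pointSequenceLaw m, PointSequence.IsRegular ω := by
  have h1 := ae_pointSequenceLaw_of_forall (m := m) fun k =>
    ae_poissonConfig_forall (ν := shellMeasure m k) (q := fun p => p.1 ∈ shell d k) (by
      filter_upwards [ae_restrict_mem ((measurableSet_shell k).prod MeasurableSet.univ)]
        with p hp using hp.1)
  have h2 := ae_pointSequenceLaw_of_forall (m := m) fun k =>
    ae_poissonConfig_injective (ν := shellMeasure m k) (fun x => by
      refine measure_mono_null (fun p hp => ?_) (Measure.restrict_le_self.absolutelyContinuous
        (hm x))
      exact ⟨hp, trivial⟩)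
  filter_upwards [h1, h2] with ω hω1 hω2
  refine ⟨fun j => hω1 j.1 j.2, ?_⟩
  rintro ⟨k, i⟩ ⟨l, j⟩ h
  have hkl : k = l := by
    rw [← show _ = k from hω1 k i, ← show _ = l from hω1 l j]
    exact congrArg (fun x : Euc d => ⌊‖x‖⌋₊) h
  subst hkl
  exact congrArg (Sigma.mk k) (hω2 k h)

theorem ae_forall_point {m : Measure (Euc d × PosReal)} [IsLocallyFiniteLevy m]
    {q : Euc d × PosReal → Prop} (h : ∀ᵐ p ∂m, q p) :
    ∀ᵐ ω ∂pointSequenceLaw m, ∀ k i, q ((ω k).2 i) :=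
  ae_pointSequenceLaw_of_forall (p := fun _ c => ∀ i, q (c.2 i)) fun _ =>
    ae_poissonConfig_forall (ae_restrict_of_ae h)

/-- The exponential formula on the first `K` shells; as `w = 0` off the ball, the integrand `e^w -
1` loses nothing by restriction to it. -/
theorem integral_pointSequenceLaw_exp {m : Measure (Euc d × PosReal)} [IsLocallyFiniteLevy m]
    {w : Euc d × PosReal → ℂ} (hw : Measurable w) (K : ℕ)
    (hi : IntegrableOn (fun p => Complex.exp (w p)) (Metric.ball 0 K ×ˢ Set.univ) m)
    (h0 : ∀ p : Euc d × PosReal, p.1 ∉ Metric.ball 0 (K : ℝ) → w p = 0) :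
    ∫ ω, Complex.exp (∑ k ∈ Finset.range K, ∑ i, w ((ω k).2 i)) ∂pointSequenceLaw m =
      Complex.exp (∫ p, (Complex.exp (w p) - 1) ∂m) := by
  simp_rw [Complex.exp_sum]
  refine (integral_infinitePi_poissonConfig_prod hw.cexp K fun k hk => ?_).trans ?_
  · exact hi.mono_set (Set.prod_mono_left (shell_subset_ball hk))
  · rw [sum_shellMeasure, setIntegral_eq_integral_of_forall_compl_eq_zero]
    intro p hp
    rw [h0 p fun h => hp ⟨h, trivial⟩, Complex.exp_zero, sub_self]

end PointSequence

/-! ### Existence, uniqueness and independence for `μ_m` -/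

section CompletelyRandom

variable {d : ℕ}

/-- The completely random discrete measure with Lévy measure `m`. -/
noncomputable def completelyRandomMeasure (m : Measure (Euc d × PosReal)) :
    Measure (DiscreteMeasure d) :=
  (pointSequenceLaw m).map PointSequence.toDiscreteMeasure

variable {m : Measure (Euc d × PosReal)} [IsLocallyFiniteLevy m]

instance : IsProbabilityMeasure (completelyRandomMeasure m) :=
  Measure.isProbabilityMeasure_map PointSequence.measurable_toDiscreteMeasure.aemeasurable

theorem measure_ball_lt_top (m : Measure (Euc d × PosReal)) [IsLocallyFiniteLevy m] (r : ℝ) :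
    m (Metric.ball 0 r ×ˢ Set.univ) < ∞ :=
  IsLocallyFiniteLevy.lt_top _ measurableSet_ball Metric.isBounded_ball

theorem integrableOn_exp_I_mul (m : Measure (Euc d × PosReal)) [IsLocallyFiniteLevy m]
    {g : Euc d × PosReal → ℝ} (hg : Measurable g) (r : ℝ) :
    IntegrableOn (fun p => Complex.exp (Complex.I * (g p : ℂ)))
      (Metric.ball 0 r ×ˢ Set.univ) m := by
  have := isFiniteMeasure_restrict.2 (measure_ball_lt_top m r).ne
  refine Integrable.of_bound (by fun_prop) 1 (Filter.Eventually.of_forall fun p => ?_)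
  rw [mul_comm, Complex.norm_exp_ofReal_mul_I]

/-- The Fourier formula for the step function `∑ t_j 1_{A_j}`, which is not a continuous test
function; it supplies the joint characteristic functions of the masses. -/
theorem integral_exp_sum_apply (hm : ∀ x : Euc d, m ({x} ×ˢ Set.univ) = 0) {ι : Type*}
    (J : Finset ι) {A : ι → Set (Euc d)} (hA : ∀ i, MeasurableSet (A i))
    (hb : ∀ i, Bornology.IsBounded (A i)) (t : ι → ℝ) :
    ∫ η, Complex.exp (Complex.I * ((∑ j ∈ J, t j * (η.toMeasure (A j)).toReal : ℝ) : ℂ))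
      ∂completelyRandomMeasure m =
    Complex.exp (∫ p : Euc d × PosReal, (Complex.exp (Complex.I *
      (((p.2 : ℝ) * ∑ j ∈ J, (A j).indicator (fun _ => t j) p.1 : ℝ) : ℂ)) - 1) ∂m) := by
  have hmeas : Measurable fun η : DiscreteMeasure d =>
      ∑ j ∈ J, t j * (η.toMeasure (A j)).toReal :=
    Finset.measurable_fun_sum _ fun j _ =>
      ((DiscreteMeasure.measurable_apply (hA j) (hb j)).ennreal_toReal).const_mul _
  have hme : Measurable fun η : DiscreteMeasure d => Complex.exp (Complex.I *
      ((∑ j ∈ J, t j * (η.toMeasure (A j)).toReal : ℝ) : ℂ)) :=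
    Complex.measurable_exp.comp (measurable_const.mul (Complex.measurable_ofReal.comp hmeas))
  obtain ⟨K, hK⟩ : ∃ K : ℕ, ∀ j ∈ J, A j ⊆ Metric.ball 0 K := by
    obtain ⟨K, hK⟩ := PointSequence.exists_subset_ball
      ((Bornology.isBounded_biUnion_finset J).2 fun j _ => hb j)
    exact ⟨K, fun j hj => (Set.subset_biUnion_of_mem (u := A) hj).trans hK⟩
  have hg : Measurable fun p : Euc d × PosReal =>
      (p.2 : ℝ) * ∑ j ∈ J, (A j).indicator (fun _ => t j) p.1 := by
    refine Measurable.mul (by fun_prop) (Finset.measurable_fun_sum _ fun j _ => ?_)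
    exact (measurable_const.indicator (hA j)).comp measurable_fst
  rw [completelyRandomMeasure, integral_map
    PointSequence.measurable_toDiscreteMeasure.aemeasurable hme.aestronglyMeasurable,
    ← integral_pointSequenceLaw_exp (K := K) (by fun_prop) (integrableOn_exp_I_mul m hg K)]
  · refine integral_congr_ae ?_
    filter_upwards [ae_isRegular hm] with ω hω
    congr 1
    simp_rw [← Finset.mul_sum, ← Complex.ofReal_sum]
    congr 2
    have h : ∀ j ∈ J, (ω.toDiscreteMeasure.toMeasure (A j)).toReal =
        ∑ k ∈ Finset.range K, ∑ i, (A j).indicator (fun _ => (((ω k).2 i).2 : ℝ)) ((ω k).2 i).1 := by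
      intro j hj
      have hc : ∀ k ∈ Finset.range K, ∀ i, PointSequence.contribution k ((ω k).2 i) (A j) =
          (A j).indicator (fun _ => ENNReal.ofReal (((ω k).2 i).2 : ℝ)) ((ω k).2 i).1 := by
        intro k _ i
        have hfl : ⌊‖((ω k).2 i).1‖⌋₊ = k := hω.floor_norm ⟨k, i⟩
        rw [PointSequence.contribution_apply _ _ (hA j)]
        by_cases hx : ((ω k).2 i).1 ∈ A j <;> simp [hx, hfl]
      have hne : ∀ k i, (A j).indicator (fun _ => ENNReal.ofReal (((ω k).2 i).2 : ℝ))
          ((ω k).2 i).1 ≠ ∞ := by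
        intro k i
        by_cases hx : ((ω k).2 i).1 ∈ A j <;> simp [hx]
      rw [show ω.toDiscreteMeasure.toMeasure (A j) = _ from ω.toMeasure_apply (hA j) (hK j hj),
        Finset.sum_congr rfl fun k hk => Finset.sum_congr rfl fun i _ => hc k hk i,
        ENNReal.toReal_sum fun k _ => ENNReal.sum_ne_top.2 fun i _ => hne k i]
      refine Finset.sum_congr rfl fun k _ => ?_
      rw [ENNReal.toReal_sum fun i _ => hne k i]
      refine Finset.sum_congr rfl fun i _ => ?_
      by_cases hx : ((ω k).2 i).1 ∈ A j
      · simp only [Set.indicator_of_mem hx]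
        exact ENNReal.toReal_ofReal (le_of_lt ((ω k).2 i).2.2)
      · simp only [Set.indicator_of_notMem hx, ENNReal.toReal_zero]
    rw [Finset.sum_congr rfl fun j hj => by rw [h j hj]]
    simp_rw [Finset.mul_sum]
    rw [Finset.sum_comm]
    refine Finset.sum_congr rfl fun k _ => ?_
    rw [Finset.sum_comm]
    refine Finset.sum_congr rfl fun i _ => Finset.sum_congr rfl fun j _ => ?_
    by_cases hx : ((ω k).2 i).1 ∈ A j <;> simp [hx, mul_comm]
  · intro p hp
    have : ∑ j ∈ J, (A j).indicator (fun _ => t j) p.1 = 0 :=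
      Finset.sum_eq_zero fun j hj => Set.indicator_of_notMem (fun h => hp (hK j hj h)) _
    simp [this]

/-- At each location at most one indicator is nonzero, so `e^{is ∑ t_j 1_{A_j}} - 1` is the sum of
the single terms `e^{is t_j 1_{A_j}} - 1` and the joint characteristic function factorises. -/
theorem isCompletelyRandom_completelyRandomMeasure (hm : ∀ x : Euc d, m ({x} ×ˢ Set.univ) = 0) :
    IsCompletelyRandom (completelyRandomMeasure m) := by
  intro n A _ hA hb hd
  have hX : ∀ i, Measurable fun η : DiscreteMeasure d => (η.toMeasure (A i)).toReal := fun i =>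
    (DiscreteMeasure.measurable_apply (hA i) (hb i)).ennreal_toReal
  have hind : iIndepFun (fun i (η : DiscreteMeasure d) => (η.toMeasure (A i)).toReal)
      (completelyRandomMeasure m) := by
    rw [iIndepFun_iff_charFun_pi fun i => (hX i).aemeasurable]
    intro t
    have hs : ∀ i, charFun ((completelyRandomMeasure m).map
        fun η : DiscreteMeasure d => (η.toMeasure (A i)).toReal) (t i) =
        Complex.exp (∫ p : Euc d × PosReal, (Complex.exp (Complex.I *
          (((p.2 : ℝ) * (A i).indicator (fun _ => t i) p.1 : ℝ) : ℂ)) - 1) ∂m) := by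
      intro i
      have h := integral_exp_sum_apply hm {i} hA hb t
      simp only [Finset.sum_singleton] at h
      rw [← h, charFun_apply_real, integral_map (hX i).aemeasurable (by fun_prop)]
      refine integral_congr_ae (Filter.Eventually.of_forall fun η => ?_)
      simp [mul_comm]
    have hf := integral_exp_sum_apply hm Finset.univ hA hb t
    have hmt : Measurable fun η : DiscreteMeasure d =>
        WithLp.toLp 2 fun i => (η.toMeasure (A i)).toReal :=
      (WithLp.measurable_toLp 2 _).comp (measurable_pi_lambda _ hX)
    simp_rw [hs]
    rw [charFun_apply, integral_map hmt.aemeasurable (by fun_prop), ← Complex.exp_sum,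
      ← integral_finsetSum]
    · refine Eq.trans ?_ (hf.trans ?_)
      · refine integral_congr_ae (Filter.Eventually.of_forall fun η => ?_)
        simp [PiLp.inner_apply, mul_comm]
      · congr 1
        refine integral_congr_ae (Filter.Eventually.of_forall fun p => ?_)
        by_cases hp : ∃ i, p.1 ∈ A i
        · obtain ⟨i, hi⟩ := hp
          have h0 : ∀ j, j ≠ i → (A j).indicator (fun _ => t j) p.1 = 0 := fun j hj =>
            Set.indicator_of_notMem (fun h => Set.disjoint_left.1 (hd hj) h hi) _
          dsimp only
          rw [Finset.sum_eq_single i (fun j _ hj => h0 j hj) (by simp),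
            Finset.sum_eq_single i (fun j _ hj => by simp [h0 j hj]) (by simp)]
        · push Not at hp
          simp [hp]
    · intro i _
      obtain ⟨K, hK⟩ := PointSequence.exists_subset_ball (hb i)
      have hg : Measurable fun p : Euc d × PosReal =>
          (p.2 : ℝ) * (A i).indicator (fun _ => t i) p.1 :=
        Measurable.mul (by fun_prop) ((measurable_const.indicator (hA i)).comp measurable_fst)
      have hfin := isFiniteMeasure_restrict.2 (measure_ball_lt_top m K).ne
      refine (IntegrableOn.sub (integrableOn_exp_I_mul m hg K)
        (integrable_const 1)).integrable_of_forall_notMem_eq_zero fun p hp => ?_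
      have : p.1 ∉ A i := fun h => hp ⟨hK h, trivial⟩
      simp [this]
  -- Characteristic functions need real variables; since bounded sets have finite mass,
  -- `ENNReal.ofReal` recovers the original ones.
  have := hind.comp (fun _ => ENNReal.ofReal) fun _ => ENNReal.measurable_ofReal
  convert this using 2 with i
  funext η
  exact (ENNReal.ofReal_toReal (η.apply_lt_top_of_isBounded (hb i)).ne).symm

/-- A generalized Fourier transform of the completely random measure, with an exponential weight
depending on the marked atoms in a ball. -/
theorem integral_exp_mul_exp_ballMarks (hm : ∀ x : Euc d, m ({x} ×ˢ Set.univ) = 0)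
    {v : Euc d × PosReal → ℝ} (hv : Measurable v) {K r : ℕ} (hr : r ≤ K)
    (hi : IntegrableOn (fun p => Real.exp (v p)) (Metric.ball 0 K ×ˢ Set.univ) m)
    (h0 : ∀ p : Euc d × PosReal, p.1 ∉ Metric.ball 0 (r : ℝ) → v p = 0)
    {f : Euc d → ℝ} (hf : Continuous f) (hc : HasCompactSupport f)
    (hK : tsupport f ⊆ Metric.ball 0 K) :
    ∫ η, Complex.exp (Complex.I * ((∫ x, f x ∂η.toMeasure : ℝ) : ℂ)) *
        (Real.exp (∫ p, v p ∂η.ballMarks r) : ℂ) ∂completelyRandomMeasure m =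
      Complex.exp (∫ p : Euc d × PosReal,
        (Complex.exp (Complex.I * (((p.2 : ℝ) * f p.1 : ℝ) : ℂ)) * (Real.exp (v p) : ℂ) - 1) ∂m) := by
  have hm1 := DiscreteMeasure.measurable_integral hf hc
  have hm2 := DiscreteMeasure.measurable_integral_ballMarks r hv
  have hfm := hf.measurable
  have hg : Measurable fun p : Euc d × PosReal => (p.2 : ℝ) * f p.1 := by fun_prop
  have hexp : ∀ p : Euc d × PosReal, Complex.exp (Complex.I * (((p.2 : ℝ) * f p.1 : ℝ) : ℂ)) *
      (Real.exp (v p) : ℂ) =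
      Complex.exp (Complex.I * (((p.2 : ℝ) * f p.1 : ℝ) : ℂ) + (v p : ℂ)) := by
    intro p
    rw [Complex.exp_add, Complex.ofReal_exp]
  simp_rw [hexp]
  rw [completelyRandomMeasure, integral_map
    PointSequence.measurable_toDiscreteMeasure.aemeasurable (by fun_prop),
    ← integral_pointSequenceLaw_exp (K := K) (by fun_prop)]
  · refine integral_congr_ae ?_
    filter_upwards [ae_isRegular hm] with ω hω
    -- The weight reads only the ball of radius `r`, while `f` needs radius `K`; the extra shells
    -- contribute zero since `v` vanishes there.
    have hrK : ∑ k ∈ Finset.range r, ∑ i, v ((ω k).2 i) =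
        ∑ k ∈ Finset.range K, ∑ i, v ((ω k).2 i) := by
      refine Finset.sum_subset (Finset.range_mono hr) fun k _ hk =>
        Finset.sum_eq_zero fun i _ => h0 _ fun h => hk ?_
      exact Finset.mem_range.2 ((hω.mem_ball_iff ⟨k, i⟩ r).1 h)
    rw [hω.integral_eq hf hc hK, hω.integral_ballMarks_eq r hv, hrK, Complex.ofReal_exp,
      ← Complex.exp_add]
    congr 1
    push_cast
    simp only [Finset.sum_add_distrib, Finset.mul_sum]
  · simp_rw [← hexp]
    refine Integrable.mono' hi (by fun_prop) (Filter.Eventually.of_forall fun p => ?_)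
    rw [norm_mul, mul_comm Complex.I, Complex.norm_exp_ofReal_mul_I, one_mul,
      Complex.norm_real, Real.norm_of_nonneg (Real.exp_pos _).le]
  · intro p hp
    rw [h0 p fun h => hp (Metric.ball_subset_ball (Nat.cast_le.2 hr) h), image_eq_zero_of_notMem_tsupport fun h => hp (hK h)]
    simp

theorem fourier_completelyRandomMeasure (hm : ∀ x : Euc d, m ({x} ×ˢ Set.univ) = 0)
    {f : Euc d → ℝ} (hf : Continuous f) (hc : HasCompactSupport f) :
    ∫ η, Complex.exp (Complex.I * ((∫ x, f x ∂η.toMeasure : ℝ) : ℂ))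
        ∂completelyRandomMeasure m =
      Complex.exp (∫ p : Euc d × PosReal,
        (Complex.exp (Complex.I * (((p.2 : ℝ) * f p.1 : ℝ) : ℂ)) - 1) ∂m) := by
  obtain ⟨K, hK⟩ := PointSequence.exists_subset_ball hc.isCompact.isBounded
  have := integral_exp_mul_exp_ballMarks hm (v := fun _ => 0) measurable_const le_rfl
    (by simpa using (measure_ball_lt_top m K)) (fun _ _ => rfl) hf hc hK
  simpa using this

theorem isCompletelyRandomWithLevyMeasure_completelyRandomMeasure
    (hm : ∀ x : Euc d, m ({x} ×ˢ Set.univ) = 0) :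
    IsCompletelyRandomWithLevyMeasure m (completelyRandomMeasure m) where
  isProbabilityMeasure := inferInstance
  isCompletelyRandom := isCompletelyRandom_completelyRandomMeasure hm
  fourier _ hf hc := fourier_completelyRandomMeasure hm hf hc

theorem IsCompletelyRandomWithLevyMeasure.eq_completelyRandomMeasure
    (hm : ∀ x : Euc d, m ({x} ×ˢ Set.univ) = 0) {μ : Measure (DiscreteMeasure d)}
    (hμ : IsCompletelyRandomWithLevyMeasure m μ) : μ = completelyRandomMeasure m := by
  have := hμ.isProbabilityMeasure
  refine DiscreteMeasure.ext_of_fourier fun f hf hc => ?_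
  rw [hμ.fourier f hf hc, fourier_completelyRandomMeasure hm hf hc]

theorem ae_isLocallyFinite (hm : ∀ x : Euc d, m ({x} ×ˢ Set.univ) = 0) :
    ∀ᵐ η ∂completelyRandomMeasure m, η.IsLocallyFinite := by
  refine (ae_map_iff PointSequence.measurable_toDiscreteMeasure.aemeasurable
    DiscreteMeasure.measurableSet_isLocallyFinite).2 ?_
  filter_upwards [ae_isRegular hm] with ω hω using hω.isLocallyFinite

/-- Allows a density on `X × ℝ₊` to be replaced by an almost everywhere equal version,
simultaneously at all atoms. -/
theorem ae_forall_markedAtom (hm : ∀ x : Euc d, m ({x} ×ˢ Set.univ) = 0)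
    {q : Euc d × PosReal → Prop} (hq : ∀ᵐ p ∂m, q p) :
    ∀ᵐ η ∂completelyRandomMeasure m, ∀ x, q (η.markedAtom x) := by
  -- The set where `q` fails need not be measurable. For a measurable null superset `Z`, the number
  -- of marked atoms in `Z` is a measurable function of `η`.
  obtain ⟨Z, hqZ, hZ, hmZ⟩ := exists_measurable_superset_of_null hq
  have hae : ∀ᵐ η ∂completelyRandomMeasure m, ∀ K : ℕ, η.ballMarks K Z = 0 := by
    refine ae_all_iff.2 fun K => ?_
    refine (ae_map_iff PointSequence.measurable_toDiscreteMeasure.aemeasurable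
      (measurableSet_eq_fun ((Measure.measurable_coe hZ).comp
        (DiscreteMeasure.measurable_ballMarks K)) measurable_const)).2 ?_
    filter_upwards [ae_isRegular hm, ae_forall_point (measure_eq_zero_iff_ae_notMem.1 hmZ)]
      with ω hω hωZ
    rw [Function.comp_apply, DiscreteMeasure.ballMarks_eq_zero_iff hω.isLocallyFinite K hZ]
    rintro ⟨x, hx⟩ _
    obtain ⟨j, rfl⟩ := hω.mem_atoms_iff.1 hx
    rw [hω.markedAtom_eq]
    exact hωZ j.1 j.2
  filter_upwards [ae_isLocallyFinite hm, hae] with η hη hηZ x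
  obtain ⟨K, hK⟩ := exists_nat_gt ‖(x : Euc d)‖
  by_contra h
  exact (DiscreteMeasure.ballMarks_eq_zero_iff hη K hZ).1 (hηZ K) x
    (mem_ball_zero_iff.2 hK) (hqZ h)

end CompletelyRandom

/-! ### The density of the transformed measure -/

section Diffeomorphism

variable {d : ℕ}

namespace Diff0

variable (φ : Diff0 d)

theorem measurable_toFun : Measurable φ.toFun := φ.toHomeo.continuous.measurable

theorem measurable_invFun : Measurable φ.invFun := φ.toHomeo.symm.continuous.measurable

theorem measurable_lift : Measurable φ.lift :=
  (φ.measurable_toFun.comp measurable_fst).prodMk measurable_snd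

theorem exists_forall_notMem_ball : ∃ r : ℕ, ∀ x ∉ Metric.ball (0 : Euc d) r, φ.toFun x = x := by
  obtain ⟨C, hC, hφ⟩ := φ.compact_support
  obtain ⟨r, hr⟩ := PointSequence.exists_subset_ball hC.isBounded
  exact ⟨r, fun x hx => hφ x fun h => hx (hr h)⟩

variable {φ}

theorem mem_iff_of_forall_notMem {B : Set (Euc d)} (h : ∀ x ∉ B, φ.toFun x = x) (x : Euc d) :
    φ.toFun x ∈ B ↔ x ∈ B := by
  constructor
  · intro hx
    by_contra hx'
    exact hx' (h x hx' ▸ hx)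
  · intro hx
    by_contra hx'
    have := φ.toEquiv.injective (h _ hx')
    refine hx' ?_
    rw [show φ.toFun x = x from this]
    exact hx

end Diff0

variable {m : Measure (Euc d × PosReal)}

instance [IsLocallyFiniteLevy m] (φ : Diff0 d) : IsLocallyFiniteLevy (m.map φ.lift) := by
  refine ⟨fun Λ hΛ hb => ?_⟩
  rw [Measure.map_apply φ.measurable_lift (hΛ.prod MeasurableSet.univ)]
  have h : φ.lift ⁻¹' (Λ ×ˢ Set.univ) = (φ.toFun ⁻¹' Λ) ×ˢ Set.univ := by
    ext p
    simp [Diff0.lift]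
  rw [h]
  exact IsLocallyFiniteLevy.lt_top _ (φ.measurable_toFun hΛ)
    ((φ.toHomeo.isCompact_preimage.2 hb.isCompact_closure).isBounded.subset
      (Set.preimage_mono subset_closure))

instance [IsLocallyFiniteLevy m] : SigmaFinite m := by
  refine ⟨⟨⟨fun n => Metric.ball 0 (n : ℝ) ×ˢ Set.univ, fun _ => trivial,
    fun n => measure_ball_lt_top m n, ?_⟩⟩⟩
  rw [← Set.iUnion_prod_const, Metric.iUnion_ball_nat, Set.univ_prod_univ]

/-- Because `⟨f, φ^*η⟩ = ⟨f ∘ φ, η⟩` and `f ∘ φ` is again a test function. -/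
theorem fourier_map_act [IsLocallyFiniteLevy m] (hm : ∀ x : Euc d, m ({x} ×ˢ Set.univ) = 0)
    (φ : Diff0 d) {f : Euc d → ℝ} (hf : Continuous f) (hc : HasCompactSupport f) :
    ∫ η, Complex.exp (Complex.I * ((∫ x, f x ∂η.toMeasure : ℝ) : ℂ))
        ∂(completelyRandomMeasure m).map φ.act =
      Complex.exp (∫ p : Euc d × PosReal,
        (Complex.exp (Complex.I * (((p.2 : ℝ) * f p.1 : ℝ) : ℂ)) - 1) ∂m.map φ.lift) := by
  have hm1 := DiscreteMeasure.measurable_integral hf hc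
  have hme : Measurable fun η : DiscreteMeasure d =>
      Complex.exp (Complex.I * ((∫ x, f x ∂η.toMeasure : ℝ) : ℂ)) :=
    ((Complex.measurable_ofReal.comp hm1).const_mul _).cexp
  have hfm := hf.measurable
  rw [integral_map φ.measurable_act.aemeasurable
      hme.aestronglyMeasurable,
    integral_map φ.measurable_lift.aemeasurable (by fun_prop)]
  have hg := fourier_completelyRandomMeasure hm (f := f ∘ φ.toHomeo)
    (hf.comp φ.toHomeo.continuous) (hc.comp_homeomorph φ.toHomeo)
  refine Eq.trans ?_ hg
  congr 1 with η
  have : ∫ x, f x ∂(φ.act η).toMeasure = ∫ x, (f ∘ φ.toHomeo) x ∂η.toMeasure :=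
    integral_map φ.measurable_toFun.aemeasurable hf.aestronglyMeasurable
  rw [this]

/-- The Radon-Nikodym derivative of the image of `m` is one outside a ball containing the support
of the diffeomorphism. -/
theorem rnDeriv_map_lift_eq_one [IsLocallyFiniteLevy m] {φ : Diff0 d} (hac : m.map φ.lift ≪ m)
    {r : ℕ} (hr : ∀ x ∉ Metric.ball (0 : Euc d) r, φ.toFun x = x) :
    ∀ᵐ p ∂m, p.1 ∉ Metric.ball (0 : Euc d) r → (m.map φ.lift).rnDeriv m p = 1 := by
  have hB : MeasurableSet ((Metric.ball (0 : Euc d) r ×ˢ (Set.univ : Set PosReal))ᶜ) :=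
    (measurableSet_ball.prod MeasurableSet.univ).compl
  have h : (m.map φ.lift).rnDeriv m =ᵐ[m.restrict
      ((Metric.ball (0 : Euc d) r ×ˢ (Set.univ : Set PosReal))ᶜ)] fun _ => 1 := by
    refine ae_eq_of_forall_setLIntegral_eq_of_sigmaFinite (Measure.measurable_rnDeriv _ _)
      measurable_const fun s hs _ => ?_
    rw [Measure.restrict_restrict hs, ← withDensity_apply _ (hs.inter hB),
      Measure.withDensity_rnDeriv_eq _ _ hac, Measure.map_apply φ.measurable_lift (hs.inter hB),
      setLIntegral_one]
    congr 1
    ext p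
    have h1 := Diff0.mem_iff_of_forall_notMem hr p.1
    by_cases hp : p.1 ∈ Metric.ball (0 : Euc d) r
    · have : φ.toFun p.1 ∈ Metric.ball (0 : Euc d) r := h1.2 hp
      simp only [Set.mem_preimage, Set.mem_inter_iff, Set.mem_compl_iff, Set.mem_prod,
        Set.mem_univ, and_true, Diff0.lift, this, hp, not_true_eq_false, and_false]
    · have : φ.lift p = p := Prod.ext (hr _ hp) rfl
      rw [Set.mem_preimage, this]
  filter_upwards [(ae_restrict_iff' hB).1 h] with p hp hpB using hp fun h => hpB h.1

/-- The logarithm turns the product over atoms into an integral against `ballMarks`. Equivalence of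
the measures makes the density positive almost everywhere, and truncation makes `v` vanish off the
ball at every point. -/
theorem exists_log_density [IsLocallyFiniteLevy m] {φ : Diff0 d} (hac : MeasEquiv (m.map φ.lift) m)
    {r : ℕ} (hr : ∀ x ∉ Metric.ball (0 : Euc d) r, φ.toFun x = x) :
    ∃ v : Euc d × PosReal → ℝ, Measurable v ∧
      (∀ p : Euc d × PosReal, p.1 ∉ Metric.ball 0 (r : ℝ) → v p = 0) ∧
      ∀ᵐ p ∂m, (m.map φ.lift).rnDeriv m p = ENNReal.ofReal (Real.exp (v p)) := by
  refine ⟨(Metric.ball (0 : Euc d) r ×ˢ (Set.univ : Set PosReal)).indicator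
    fun p => Real.log ((m.map φ.lift).rnDeriv m p).toReal, ?_, ?_, ?_⟩
  · exact ((Measure.measurable_rnDeriv _ _).ennreal_toReal.log).indicator
      (measurableSet_ball.prod MeasurableSet.univ)
  · exact fun p hp => Set.indicator_of_notMem (fun h => hp h.1) _
  · filter_upwards [rnDeriv_map_lift_eq_one hac.1 hr, Measure.rnDeriv_pos' hac.2,
      Measure.rnDeriv_lt_top (m.map φ.lift) m] with p h1 hpos htop
    by_cases hp : p.1 ∈ Metric.ball (0 : Euc d) r
    · rw [Set.indicator_of_mem (show p ∈ Metric.ball (0 : Euc d) r ×ˢ Set.univ from ⟨hp, trivial⟩),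
        Real.exp_log (ENNReal.toReal_pos hpos.ne' htop.ne), ENNReal.ofReal_toReal htop.ne]
    · rw [Set.indicator_of_notMem (fun h => hp h.1), h1 hp]
      simp

/-- Both sides are finite measures with the same Fourier transform: weighting by `e^{∑ v}` changes
`m` to `e^v m = m_φ` in the exponent. -/
theorem map_act_eq_withDensity [IsLocallyFiniteLevy m]
    (hm : ∀ x : Euc d, m ({x} ×ˢ Set.univ) = 0) {φ : Diff0 d}
    (hac : m.map φ.lift ≪ m)
    {r : ℕ} (hr : ∀ x ∉ Metric.ball (0 : Euc d) r, φ.toFun x = x)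
    {v : Euc d × PosReal → ℝ} (hv : Measurable v)
    (h0 : ∀ p : Euc d × PosReal, p.1 ∉ Metric.ball 0 (r : ℝ) → v p = 0)
    (hvd : ∀ᵐ p ∂m, (m.map φ.lift).rnDeriv m p = ENNReal.ofReal (Real.exp (v p))) :
    (completelyRandomMeasure m).map φ.act = (completelyRandomMeasure m).withDensity
      fun η => ENNReal.ofReal (Real.exp (∫ p, v p ∂η.ballMarks r)) := by
  have hmd : m.map φ.lift = m.withDensity fun p => ENNReal.ofReal (Real.exp (v p)) := by
    rw [← withDensity_congr_ae hvd, Measure.withDensity_rnDeriv_eq _ _ hac]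
  have hve : Measurable fun p => ENNReal.ofReal (Real.exp (v p)) := by fun_prop
  have hint : ∀ K : ℕ, IntegrableOn (fun p => Real.exp (v p)) (Metric.ball 0 K ×ˢ Set.univ) m := by
    intro K
    refine ⟨by fun_prop, ?_⟩
    rw [hasFiniteIntegral_iff_ofReal (Filter.Eventually.of_forall fun p => (Real.exp_pos _).le),
      ← withDensity_apply _ (measurableSet_ball.prod MeasurableSet.univ), ← hmd]
    exact measure_ball_lt_top _ K
  have hG := DiscreteMeasure.measurable_integral_ballMarks (d := d) r hv
  have hGe : Measurable fun η : DiscreteMeasure d =>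
    ENNReal.ofReal (Real.exp (∫ p, v p ∂η.ballMarks r)) := by fun_prop
  have hF : ∀ f : Euc d → ℝ, Continuous f → HasCompactSupport f →
      ∫ η, Complex.exp (Complex.I * ((∫ x, f x ∂η.toMeasure : ℝ) : ℂ)) *
        (Real.exp (∫ p, v p ∂η.ballMarks r) : ℂ) ∂completelyRandomMeasure m =
      ∫ η, Complex.exp (Complex.I * ((∫ x, f x ∂η.toMeasure : ℝ) : ℂ))
        ∂(completelyRandomMeasure m).map φ.act := by
    intro f hf hc
    obtain ⟨K', hK'⟩ := PointSequence.exists_subset_ball hc.isCompact.isBounded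
    set K := max r K'
    have hrK : r ≤ K := le_max_left _ _
    have hK : tsupport f ⊆ Metric.ball 0 K :=
      hK'.trans (Metric.ball_subset_ball (Nat.cast_le.2 (le_max_right _ _)))
    have hfm := hf.measurable
    have hg : Measurable fun p : Euc d × PosReal => (p.2 : ℝ) * f p.1 := by fun_prop
    rw [integral_exp_mul_exp_ballMarks hm hv hrK (hint K) h0 hf hc hK, fourier_map_act hm φ hf hc]
    congr 1
    set B : Set (Euc d × PosReal) := Metric.ball 0 (K : ℝ) ×ˢ Set.univ with hBdef
    have hB : MeasurableSet B := measurableSet_ball.prod MeasurableSet.univ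
    have hz : ∀ p ∉ B, v p = 0 ∧ f p.1 = 0 := fun p hp =>
      ⟨h0 p fun h => hp ⟨Metric.ball_subset_ball (Nat.cast_le.2 hrK) h, trivial⟩,
        image_eq_zero_of_notMem_tsupport fun h => hp ⟨hK h, trivial⟩⟩
    have hfin1 := isFiniteMeasure_restrict.2 (measure_ball_lt_top m K).ne
    have hfin2 := isFiniteMeasure_restrict.2 (measure_ball_lt_top (m.map φ.lift) K).ne
    rw [← setIntegral_eq_integral_of_forall_compl_eq_zero (s := B) (μ := m)
        fun p hp => by simp [hz p hp],
      ← setIntegral_eq_integral_of_forall_compl_eq_zero (s := B) (μ := m.map φ.lift)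
        fun p hp => by simp [hz p hp],
      integral_sub _ (integrable_const _), integral_sub (integrableOn_exp_I_mul _ hg K)
        (integrable_const _)]
    -- Since `φ` preserves the ball, the constant terms `-1` integrate to the same value under `m`
    -- and `m_φ`.
    · have hvol : (m.map φ.lift).real B = m.real B := by
        rw [measureReal_def, Measure.map_apply φ.measurable_lift hB, measureReal_def]
        congr 2
        ext p
        have := Diff0.mem_iff_of_forall_notMem (φ := φ) (B := Metric.ball 0 (K : ℝ))
          (fun x hx => hr x fun h => hx (Metric.ball_subset_ball (Nat.cast_le.2 hrK) h)) p.1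
        simp only [hBdef, Set.mem_preimage, Set.mem_prod, Set.mem_univ, and_true, Diff0.lift, this]
      congr 1
      · conv_rhs => rw [hmd]
        rw [setIntegral_withDensity_eq_setIntegral_toReal_smul hve (by simp) _ hB]
        refine setIntegral_congr_fun hB fun p _ => ?_
        rw [ENNReal.toReal_ofReal (Real.exp_pos _).le, Complex.real_smul, mul_comm]
      · simpa using hvol.symm
    · refine Integrable.mono' (hint K) (by fun_prop) (Filter.Eventually.of_forall fun p => ?_)
      rw [norm_mul, mul_comm Complex.I, Complex.norm_exp_ofReal_mul_I, one_mul,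
        Complex.norm_real, Real.norm_of_nonneg (Real.exp_pos _).le]
  have hprob : IsProbabilityMeasure ((completelyRandomMeasure m).map φ.act) :=
    Measure.isProbabilityMeasure_map φ.measurable_act.aemeasurable
  -- Integrability comes from `hF` at `f = 0`: the right side is `1`, whereas a nonintegrable
  -- function has integral `0` by convention.
  have hfinite : IsFiniteMeasure ((completelyRandomMeasure m).withDensity
      fun η => ENNReal.ofReal (Real.exp (∫ p, v p ∂η.ballMarks r))) := by
    have h1 := hF (fun _ => 0) continuous_const HasCompactSupport.zero
    have hi : Integrable (fun η : DiscreteMeasure d =>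
        (Real.exp (∫ p, v p ∂η.ballMarks r) : ℂ)) (completelyRandomMeasure m) := by
      by_contra h
      simp only [integral_zero, Complex.ofReal_zero, mul_zero, Complex.exp_zero, one_mul] at h1
      rw [integral_undef h] at h1
      simp at h1
    refine isFiniteMeasure_withDensity_ofReal (f := fun η : DiscreteMeasure d =>
      Real.exp (∫ p, v p ∂η.ballMarks r)) ?_
    exact hi.re.hasFiniteIntegral
  refine DiscreteMeasure.ext_of_fourier fun f hf hc => ?_
  rw [← hF f hf hc, integral_withDensity_eq_integral_toReal_smul hGe (by simp)]
  congr 1 with η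
  rw [ENNReal.toReal_ofReal (Real.exp_pos _).le, Complex.real_smul, mul_comm]

/-- Only the finitely many atoms in the ball can have a factor other than `1`, hence the
unconditional convergence. -/
theorem hasProd_markedAtom {η : DiscreteMeasure d} (hη : η.IsLocallyFinite) {r : ℕ}
    {v : Euc d × PosReal → ℝ} (hv : Measurable v)
    (h0 : ∀ p : Euc d × PosReal, p.1 ∉ Metric.ball 0 (r : ℝ) → v p = 0) :
    HasProd (fun x : η.atoms => ENNReal.ofReal (Real.exp (v (η.markedAtom x))))
      (ENNReal.ofReal (Real.exp (∫ p, v p ∂η.ballMarks r))) := by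
  have := (hη r).fintype
  rw [DiscreteMeasure.integral_ballMarks hη r hv, Real.exp_sum,
    ENNReal.ofReal_prod_of_nonneg fun _ _ => (Real.exp_pos _).le]
  refine (Function.Injective.hasProd_iff
    (g := fun x : ↥(η.atoms ∩ Metric.ball 0 r) => (⟨x, x.2.1⟩ : η.atoms)) ?_ ?_).1
    (hasProd_fintype _)
  · exact fun x y h => Subtype.ext (congrArg (fun z : η.atoms => (z : Euc d)) h)
  · intro x hx
    have hxv : v (η.markedAtom x) = 0 := h0 _ fun h =>
      hx ⟨⟨(x : Euc d), x.2, show (x : Euc d) ∈ Metric.ball 0 (r : ℝ) from h⟩, Subtype.ext rfl⟩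
    rw [hxv, Real.exp_zero, ENNReal.ofReal_one]

theorem quasiInvariant_and_hasProd [IsLocallyFiniteLevy m]
    (hm : ∀ x : Euc d, m ({x} ×ˢ Set.univ) = 0) {φ : Diff0 d}
    (hac : MeasEquiv (m.map φ.lift) m) :
    MeasEquiv ((completelyRandomMeasure m).map φ.act) (completelyRandomMeasure m) ∧
      ∀ᵐ η ∂completelyRandomMeasure m,
        HasProd (fun x : η.atoms => (m.map φ.lift).rnDeriv m (η.markedAtom x))
          (((completelyRandomMeasure m).map φ.act).rnDeriv (completelyRandomMeasure m) η) := by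
  obtain ⟨r, hr⟩ := φ.exists_forall_notMem_ball
  obtain ⟨v, hv, h0, hvd⟩ := exists_log_density hac hr
  have hGe : Measurable fun η : DiscreteMeasure d =>
      ENNReal.ofReal (Real.exp (∫ p, v p ∂η.ballMarks r)) := by
    have hG := DiscreteMeasure.measurable_integral_ballMarks (d := d) r hv
    fun_prop
  rw [map_act_eq_withDensity hm hac.1 hr hv h0 hvd]
  refine ⟨⟨withDensity_absolutelyContinuous _ _, withDensity_absolutelyContinuous'
    hGe.aemeasurable (Filter.Eventually.of_forall fun η =>
      (ENNReal.ofReal_pos.2 (Real.exp_pos _)).ne')⟩, ?_⟩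
  filter_upwards [ae_isLocallyFinite hm, ae_forall_markedAtom hm hvd,
    Measure.rnDeriv_withDensity (completelyRandomMeasure m) hGe] with η hη hηv hηd
  rw [hηd]
  simp_rw [hηv]
  exact hasProd_markedAtom hη hv h0

end Diffeomorphism

/-! ### Lévy measures with a density -/

section LevyDensity

variable {d : ℕ}

instance : SigmaFinite ((volume : Measure ℝ).comap (Subtype.val : PosReal → ℝ)) := by
  refine SigmaFinite.of_map _ measurable_subtype_coe.aemeasurable ?_
  rw [(MeasurableEmbedding.subtype_coe measurableSet_Ioi).map_comap]
  infer_instance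

namespace Diff0

variable (φ : Diff0 d)

theorem differentiable_toFun : Differentiable ℝ φ.toFun :=
  φ.contDiff_toFun.differentiable (by simp)

theorem differentiable_invFun : Differentiable ℝ φ.invFun :=
  φ.contDiff_invFun.differentiable (by simp)

theorem measurable_jac : Measurable φ.jac := by
  have h : Measurable fun x => (fderiv ℝ φ.invFun x).det :=
    ContinuousLinearMap.continuous_det.measurable.comp (measurable_fderiv ℝ φ.invFun)
  exact h.norm

/-- The chain rule for `φ ∘ φ⁻¹ = id` makes the determinant a factor of `1`. -/
theorem jac_pos (x : Euc d) : 0 < φ.jac x := by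
  refine abs_pos.2 fun h => ?_
  have hcomp : fderiv ℝ (φ.toFun ∘ φ.invFun) x =
      (fderiv ℝ φ.toFun (φ.invFun x)).comp (fderiv ℝ φ.invFun x) :=
    fderiv_comp x (φ.differentiable_toFun _) (φ.differentiable_invFun x)
  have hid : φ.toFun ∘ φ.invFun = id := funext φ.right_inv
  rw [hid, fderiv_id] at hcomp
  have hdet := congrArg ContinuousLinearMap.det hcomp
  have h1 : ((fderiv ℝ φ.toFun (φ.invFun x)).comp (fderiv ℝ φ.invFun x)).det =
      (fderiv ℝ φ.toFun (φ.invFun x)).det * (fderiv ℝ φ.invFun x).det :=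
    LinearMap.det_comp _ _
  rw [h1, h, mul_zero] at hdet
  exact one_ne_zero (LinearMap.det_id.symm.trans hdet)

theorem map_volume : (volume : Measure (Euc d)).map φ.toFun =
    volume.withDensity fun x => ENNReal.ofReal (φ.jac x) := by
  have h := map_withDensity_abs_det_fderiv_eq_addHaar (volume : Measure (Euc d))
    (s := Set.univ) (f := φ.invFun) (f' := fderiv ℝ φ.invFun) nullMeasurableSet_univ
    (fun x _ => (φ.differentiable_invFun x).hasFDerivAt.hasFDerivWithinAt)
    φ.toEquiv.symm.injective.injOn
  have hr : φ.invFun '' Set.univ = Set.univ :=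
    Set.image_univ_of_surjective φ.toEquiv.symm.surjective
  rw [hr, Measure.restrict_univ] at h
  have h2 := congrArg (Measure.map φ.toFun) h
  rw [Measure.map_map φ.measurable_toFun φ.measurable_invFun,
    show φ.toFun ∘ φ.invFun = id from funext φ.right_inv, Measure.map_id] at h2
  exact h2.symm

end Diff0

/-- The base measure acquires the factor `J_φ` and the density is composed with `φ⁻¹` in `x`; the
lift fixes `s`, so `1/s` cancels in the quotient. -/
theorem map_lift_levyOfDensity {l : Euc d × PosReal → ℝ} (hl : Measurable l) (hpos : ∀ p, 0 < l p)
    (φ : Diff0 d) : (levyOfDensity l).map φ.lift = (levyOfDensity l).withDensity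
      fun p => ENNReal.ofReal (l (φ.invFun p.1, p.2) / l p * φ.jac p.1) := by
  set base : Measure (Euc d × PosReal) :=
    (volume : Measure (Euc d)).prod ((volume : Measure ℝ).comap Subtype.val) with hbase
  have hJ := φ.measurable_jac
  have hinv := φ.measurable_invFun
  have hD : Measurable fun p : Euc d × PosReal => ENNReal.ofReal (l p / (p.2 : ℝ)) := by fun_prop
  have hD' : Measurable fun p : Euc d × PosReal =>
    ENNReal.ofReal (l (φ.invFun p.1, p.2) / (p.2 : ℝ)) := by fun_prop
  have hJ' : Measurable fun p : Euc d × PosReal => ENNReal.ofReal (φ.jac p.1) := by fun_prop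
  have hh : Measurable fun p : Euc d × PosReal =>
    ENNReal.ofReal (l (φ.invFun p.1, p.2) / l p * φ.jac p.1) := by fun_prop
  have hmapbase : base.map φ.lift = base.withDensity fun p => ENNReal.ofReal (φ.jac p.1) := by
    rw [hbase, ← prod_withDensity_left (f := fun x => ENNReal.ofReal (φ.jac x)) (by fun_prop),
      ← φ.map_volume]
    have := Measure.map_prod_map (volume : Measure (Euc d))
      ((volume : Measure ℝ).comap (Subtype.val : PosReal → ℝ)) φ.measurable_toFun measurable_id
    rw [Measure.map_id] at this
    exact this.symm
  have hpush : (levyOfDensity l).map φ.lift = (base.map φ.lift).withDensity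
      fun p => ENNReal.ofReal (l (φ.invFun p.1, p.2) / (p.2 : ℝ)) := by
    ext A hA
    rw [Measure.map_apply φ.measurable_lift hA, withDensity_apply _ hA,
      setLIntegral_map hA hD' φ.measurable_lift, levyOfDensity,
      withDensity_apply _ (φ.measurable_lift hA)]
    refine lintegral_congr fun p => ?_
    have : φ.invFun (φ.toFun p.1) = p.1 := φ.left_inv p.1
    simp only [Diff0.lift, this]
  rw [hpush, hmapbase, levyOfDensity, ← withDensity_mul _ hJ' hD', ← withDensity_mul _ hD hh]
  congr 1
  funext p
  have hs : (0 : ℝ) < p.2 := p.2.2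
  simp only [Pi.mul_apply]
  rw [← ENNReal.ofReal_mul (φ.jac_pos _).le, ← ENNReal.ofReal_mul (div_pos (hpos p) hs).le]
  congr 1
  have := (hpos p).ne'
  field_simp

/-- This is where `1 ≤ d` enters: in dimension zero, Lebesgue measure is a point mass. -/
theorem levyOfDensity_singleton_prod (hd : 1 ≤ d) (l : Euc d × PosReal → ℝ) (x : Euc d) :
    levyOfDensity l ({x} ×ˢ Set.univ) = 0 := by
  have : Nonempty (Fin d) := ⟨⟨0, hd⟩⟩
  refine withDensity_absolutelyContinuous _ _ ?_
  rw [Measure.prod_prod, measure_singleton, zero_mul]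

theorem measEquiv_map_lift_levyOfDensity {l : Euc d × PosReal → ℝ} (hl : Measurable l)
    (hpos : ∀ p, 0 < l p) (φ : Diff0 d) :
    MeasEquiv ((levyOfDensity l).map φ.lift) (levyOfDensity l) := by
  have hJ := φ.measurable_jac
  have hinv := φ.measurable_invFun
  have hh : Measurable fun p : Euc d × PosReal =>
    ENNReal.ofReal (l (φ.invFun p.1, p.2) / l p * φ.jac p.1) := by fun_prop
  rw [map_lift_levyOfDensity hl hpos]
  exact ⟨withDensity_absolutelyContinuous _ _, withDensity_absolutelyContinuous' hh.aemeasurable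
    (Filter.Eventually.of_forall fun p => (ENNReal.ofReal_pos.2
      (mul_pos (div_pos (hpos _) (hpos _)) (φ.jac_pos _))).ne')⟩

theorem rnDeriv_map_lift_levyOfDensity {l : Euc d × PosReal → ℝ} (hl : Measurable l)
    (hpos : ∀ p, 0 < l p) [SigmaFinite (levyOfDensity l)] (φ : Diff0 d) :
    ((levyOfDensity l).map φ.lift).rnDeriv (levyOfDensity l) =ᵐ[levyOfDensity l]
      fun p => ENNReal.ofReal (l (φ.invFun p.1, p.2) / l p * φ.jac p.1) := by
  have hJ := φ.measurable_jac
  have hinv := φ.measurable_invFun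
  rw [map_lift_levyOfDensity hl hpos]
  exact Measure.rnDeriv_withDensity _ (by fun_prop)

end LevyDensity

/-! ### The theorem -/

theorem existsUnique_isCompletelyRandomWithLevyMeasure {d : ℕ} {m : Measure (Euc d × PosReal)}
    [IsLocallyFiniteLevy m] (hm : ∀ x : Euc d, m ({x} ×ˢ Set.univ) = 0) :
    ∃! μ : Measure (DiscreteMeasure d), IsCompletelyRandomWithLevyMeasure m μ :=
  ⟨_, isCompletelyRandomWithLevyMeasure_completelyRandomMeasure hm,
    fun _ hμ => hμ.eq_completelyRandomMeasure hm⟩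

theorem corollary4p4 (d : ℕ) (hd : 1 ≤ d) :
    -- general Lévy measures
    (∀ m : Measure (Euc d × PosReal),
      (∀ x : Euc d, m ({x} ×ˢ Set.univ) = 0) →
      (∀ φ : Diff0 d, MeasEquiv (m.map φ.lift) m) →
      (∀ Λ : Set (Euc d), MeasurableSet Λ → Bornology.IsBounded Λ → m (Λ ×ˢ Set.univ) < ∞) →
      (∃! μ : Measure (DiscreteMeasure d), IsCompletelyRandomWithLevyMeasure m μ) ∧
      ∀ μ : Measure (DiscreteMeasure d), IsCompletelyRandomWithLevyMeasure m μ →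
        IsDiffQuasiInvariant μ ∧
        ∀ φ : Diff0 d, ∀ᵐ η ∂μ,
          HasProd (fun x : η.atoms => (m.map φ.lift).rnDeriv m ((x : Euc d), η.weight x))
            ((μ.map φ.act).rnDeriv μ η)) ∧
    -- Lévy measures of the form `(l(x,s)/s) dx ds`
    (∀ l : Euc d × PosReal → ℝ, Measurable l → (∀ p, 0 < l p) →
      (∀ Λ : Set (Euc d), MeasurableSet Λ → Bornology.IsBounded Λ →
        levyOfDensity l (Λ ×ˢ Set.univ) < ∞) →
      (∃! μ : Measure (DiscreteMeasure d),
        IsCompletelyRandomWithLevyMeasure (levyOfDensity l) μ) ∧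
      ∀ μ : Measure (DiscreteMeasure d), IsCompletelyRandomWithLevyMeasure (levyOfDensity l) μ →
        IsDiffQuasiInvariant μ ∧
        ∀ φ : Diff0 d, ∀ᵐ η ∂μ,
          HasProd (fun x : η.atoms => ENNReal.ofReal
              (l (φ.invFun x, η.weight x) / l ((x : Euc d), η.weight x) * φ.jac x))
            ((μ.map φ.act).rnDeriv μ η)) := by
  constructor
  · intro m hm hequiv hfin
    have : IsLocallyFiniteLevy m := ⟨hfin⟩
    refine ⟨existsUnique_isCompletelyRandomWithLevyMeasure hm, fun μ hμ => ?_⟩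
    rw [hμ.eq_completelyRandomMeasure hm]
    exact ⟨fun φ => (quasiInvariant_and_hasProd hm (hequiv φ)).1,
      fun φ => (quasiInvariant_and_hasProd hm (hequiv φ)).2⟩
  · intro l hl hpos hfin
    have : IsLocallyFiniteLevy (levyOfDensity l) := ⟨hfin⟩
    have hm := levyOfDensity_singleton_prod hd l
    have hequiv := measEquiv_map_lift_levyOfDensity hl hpos
    refine ⟨existsUnique_isCompletelyRandomWithLevyMeasure hm, fun μ hμ => ?_⟩
    rw [hμ.eq_completelyRandomMeasure hm]
    refine ⟨fun φ => (quasiInvariant_and_hasProd hm (hequiv φ)).1, fun φ => ?_⟩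
    -- The explicit formula agrees with `dm_φ/dm` only `m`-almost everywhere, which is enough to
    -- have equality at every marked atom of almost every `η`.
    filter_upwards [(quasiInvariant_and_hasProd hm (hequiv φ)).2,
      ae_forall_markedAtom hm (rnDeriv_map_lift_levyOfDensity hl hpos φ)] with η hη hηl
    simp_rw [hηl] at hη
    exact hη
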